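/- Let $(X,H,Y)$ be random, with features $X\in\mathcal X$, label $Y=f_Y(D)\in\{0,1\}$, $X=f_X(D)$, $V=f_V(D)$, and decision maker's confidence $H=f_H(X,V,Q)$ in a finite totally ordered set $\mathcal H$, where $D$ and $Q$ are independent exogenous variables. Write $Z=(X,H)\in\mathcal Z=\mathcal X\times\mathcal H$, $\mathcal S_h=\{(x,h')\in\mathcal Z: h'=h\}$, and, for $\mathcal S\subseteq\mathcal Z$, $|\mathcal S|=P(Z\in\mathcal S)$. A function $f:\mathcal Z\to[0,1]$ with finitely many values is *$\alpha$-calibrated with respect to* $\mathcal S\subseteq\mathcal Z$ if there is $\mathcal S'\subseteq\mathcal S$ with $|\mathcal S'|\ge(1-\alpha)|\mathcal S|$ such that $|P(Y=1\mid f(Z)=b,Z\in\mathcal S')-b|\le\alpha$ for all $b\in[0,1]$. It is *$\alpha$-aligned with respect to* $f_H$ if there are $\tilde{\mathcal S}_h\subseteq\mathcal S_h$, $h\in\mathcal H$, with $|\tilde{\mathcal S}_h|\ge(1-\alpha/2)|\mathcal S_h|$ such that $P(Y=1\mid f(Z)=b',Z\in\tilde{\mathcal S}_{h'})-P(Y=1\mid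 f(Z)=b'',Z\in\tilde{\mathcal S}_{h''})\le\alpha$ whenever $b'\le b''$ and $h'\le h''$. (Both conditions range over the conditioning events of positive probability; subsets are measurable.) It satisfies *$\alpha$-aligned calibration with respect to* $f_H$ if it is $\alpha$-aligned with respect to $f_H$ and $\alpha$-calibrated with respect to $\mathcal Z$. Let $f_B:\mathcal Z\to[0,1]$ be measurable such that the law of $f_B(Z)$ has no atoms. Let $\alpha>0$, $\xi\in(0,1)$, $\gamma>0$, $\lambda\in(0,1]$, $N=\lceil1/\lambda\rceil$, and assume $P(Z\in\mathcal S_h)\ge\gamma$ for every $h\in\mathcal H$ and $|\mathcal H|\ge2\lambda$ (this holds automatically if $|\mathcal H|\ge2$). Let $\mathcal D$ consist of $n$ i.i.d. samples of $(Z,Y)$. For every $h$, one instance of *uniform-mass binning* is run on $\mathcal D\cap\mathcal S_h$: it divides $[0,1]$ into the bins $[0,\hat q_1],[\hat q_1,\hat q_2],\dots,[\hat q_{N-1},1]$, where $\hat q_i$ is the empirical $(i/N)$-quantile of the values of $f_B$ on $\mathcal D\cap\mathcal S_h$, and the value of a bin is the fraction of labels $1$ among the samples of $\mathcal D\cap\mathcal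 S_h$ whose $f_B$-value lies in it. The discretized confidence $f_{B,\lambda}(x,h)$ is the value of the (first) bin of the instance for $h$ that contains $f_B(x,h)$ (and $0$ if $\mathcal D\cap\mathcal S_h=\emptyset$). Then there is a universal constant $C>0$ such that, whenever $$n\;\ge\;C\,\frac{|\mathcal H|}{\alpha^2\lambda\gamma}\,\log\!\left(\frac{|\mathcal H|}{\lambda\xi}\right),$$ with probability at least $1-\xi$ over the draw of $\mathcal D$ the function $f_{B,\lambda}$ satisfies $\alpha$-aligned calibration with respect to $f_H$. -/

import Mathlib

open MeasureTheory

namespace HumanAligned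

noncomputable section

/-- The part of the structural causal model of AI-assisted decision making that generates the
features `X = f_X(D)`, the additional features `V = f_V(D)`, the binary label `Y = f_Y(D)` and the
decision maker's confidence `H = f_H(X, V, Q)`, where the exogenous variables `D` and `Q` are
independent. -/
structure DecisionModel (𝒟 𝒬 𝒱 𝒳 ℋ : Type*) [MeasurableSpace 𝒟] [MeasurableSpace 𝒬]
    [MeasurableSpace 𝒱] [MeasurableSpace 𝒳] [MeasurableSpace ℋ] where
  /-- law of the data generating noise `D` -/
  lawD : Measure 𝒟
  /-- law of the decision maker's individual characteristics `Q` -/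
  lawQ : Measure 𝒬
  isProbD : IsProbabilityMeasure lawD
  isProbQ : IsProbabilityMeasure lawQ
  fX : 𝒟 → 𝒳
  fV : 𝒟 → 𝒱
  fY : 𝒟 → Fin 2
  fH : 𝒳 × 𝒱 × 𝒬 → ℋ
  measurable_fX : Measurable fX
  measurable_fV : Measurable fV
  measurable_fY : Measurable fY
  measurable_fH : Measurable fH

/-- The joint law of `(Z, Y)`, with `Z = (X, H)`, entailed by the model. -/
def DecisionModel.law {𝒟 𝒬 𝒱 𝒳 ℋ : Type*} [MeasurableSpace 𝒟] [MeasurableSpace 𝒬]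
    [MeasurableSpace 𝒱] [MeasurableSpace 𝒳] [MeasurableSpace ℋ]
    (M : DecisionModel 𝒟 𝒬 𝒱 𝒳 ℋ) : Measure ((𝒳 × ℋ) × Fin 2) :=
  (M.lawD.prod M.lawQ).map
    (fun w => ((M.fX w.1, M.fH (M.fX w.1, M.fV w.1, w.2)), M.fY w.1))

section Calibration

variable {𝒵 : Type*} [MeasurableSpace 𝒵]

/-- The event `f(Z) = b, Z ∈ S`. -/
def levelEvent (f : 𝒵 → unitInterval) (S : Set 𝒵) (b : unitInterval) : Set (𝒵 × Fin 2) :=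
  {w | f w.1 = b ∧ w.1 ∈ S}

/-- The conditional probability `P(Y = 1 | f(Z) = b, Z ∈ S)`
(meaningful when the conditioning event has positive probability). -/
def condProbOne (P : Measure (𝒵 × Fin 2)) (f : 𝒵 → unitInterval) (S : Set 𝒵)
    (b : unitInterval) : ℝ :=
  (ProbabilityTheory.cond P (levelEvent f S b)).real {w | w.2 = 1}

/-- The size `|S|` of a subspace `S` of `𝒵`: its probability `P(Z ∈ S)`. -/
def mass (P : Measure (𝒵 × Fin 2)) (S : Set 𝒵) : ℝ :=
  P.real {w | w.1 ∈ S}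

/-- `α`-calibration with respect to `S`, for a confidence function `f` with finitely many values:
up to an `α`-fraction of `S`, the conditional probability of `Y = 1` given `f(Z) = b` is within `α`
of `b`, for every `b` for which the conditioning event has positive probability. -/
def IsCalibrated (P : Measure (𝒵 × Fin 2)) (f : 𝒵 → unitInterval) (α : ℝ) (S : Set 𝒵) : Prop :=
  ∃ S' : Set 𝒵, S' ⊆ S ∧ MeasurableSet S' ∧ (1 - α) * mass P S ≤ mass P S' ∧
    ∀ b : unitInterval, 0 < P (levelEvent f S' b) →
      |condProbOne P f S' b - (b : ℝ)| ≤ α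

end Calibration

section Alignment

variable {𝒳 ℋ : Type*} [MeasurableSpace 𝒳] [MeasurableSpace ℋ]

/-- The subspace `S_h = {(x, H) ∈ 𝒵 | H = h}`. -/
def slice (𝒳 : Type*) {ℋ : Type*} (h : ℋ) : Set (𝒳 × ℋ) := {z | z.2 = h}

/-- `α`-alignment of a confidence function `f` with finitely many values with respect to the
decision maker's confidence `H`. -/
def IsAligned [LinearOrder ℋ] (P : Measure ((𝒳 × ℋ) × Fin 2)) (f : 𝒳 × ℋ → unitInterval)
    (α : ℝ) : Prop :=
  ∃ S : ℋ → Set (𝒳 × ℋ),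
    (∀ h, S h ⊆ slice 𝒳 h ∧ MeasurableSet (S h) ∧
      (1 - α / 2) * mass P (slice 𝒳 h) ≤ mass P (S h)) ∧
    ∀ (b' b'' : unitInterval) (h' h'' : ℋ), b' ≤ b'' → h' ≤ h'' →
      0 < P (levelEvent f (S h') b') → 0 < P (levelEvent f (S h'') b'') →
        condProbOne P f (S h') b' - condProbOne P f (S h'') b'' ≤ α

/-- `α`-aligned calibration: `α`-alignment together with `α`-calibration on the whole space. -/
def IsAlignedCalibrated [LinearOrder ℋ] (P : Measure ((𝒳 × ℋ) × Fin 2))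
    (f : 𝒳 × ℋ → unitInterval) (α : ℝ) : Prop :=
  IsAligned P f α ∧ IsCalibrated P f α Set.univ

end Alignment

section UMD

variable {ι : Type*}

/-- The empirical `p`-quantile `inf {t | F(t) ≥ p}` of the scores `s j`, `j ∈ J`, where `F` is their
empirical distribution function. -/
def empQuantile (J : Finset ι) (s : ι → ℝ) (p : ℝ) : ℝ :=
  sInf {t : ℝ | p * (J.card : ℝ) ≤ ((J.filter (fun j => s j ≤ t)).card : ℝ)}

/-- The endpoints `0, q_1, …, q_{N-1}, 1` of the `N` bins into which uniform-mass binning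
divides `[0, 1]`; `q_i` is the empirical `i/N`-quantile. -/
def umdEdge (J : Finset ι) (s : ι → ℝ) (N i : ℕ) : ℝ :=
  if i = 0 then 0 else if i < N then empQuantile J s ((i : ℝ) / (N : ℝ)) else 1

/-- The samples in `J` whose score lies in the `i`-th bin (`i = 0, …, N - 1`). -/
def umdBin (J : Finset ι) (s : ι → ℝ) (N i : ℕ) : Finset ι :=
  open Classical in J.filter (fun j => s j ∈ Set.Icc (umdEdge J s N i) (umdEdge J s N (i + 1)))

/-- The value of the `i`-th bin: the empirical frequency of the label `1` among its samples
(there are such samples as soon as `J` is non-empty; for empty `J` the value is `0`). -/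
def umdValue (J : Finset ι) (s : ι → ℝ) (y : ι → Fin 2) (N i : ℕ) : ℝ :=
  (((umdBin J s N i).filter (fun j => y j = 1)).card : ℝ) / ((umdBin J s N i).card : ℝ)

/-- The index of the bin containing the score `t`: the number of inner endpoints `q_1, …, q_{N-1}`
below `t`. (A score equal to an inner endpoint goes to the first bin containing it.) -/
def umdIndex (J : Finset ι) (s : ι → ℝ) (N : ℕ) (t : ℝ) : ℕ :=
  ((Finset.Ico 1 N).filter (fun i => umdEdge J s N i < t)).card

/-- One instance of uniform-mass binning with `N` bins, run on the samples `(s j, y j)`, `j ∈ J`: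
the score `t` is sent to the value of the bin containing it. -/
def umd (J : Finset ι) (s : ι → ℝ) (y : ι → Fin 2) (N : ℕ) (t : ℝ) : ℝ :=
  umdValue J s y N (umdIndex J s N t)

theorem umd_mem (J : Finset ι) (s : ι → ℝ) (y : ι → Fin 2) (N : ℕ) (t : ℝ) :
    umd J s y N t ∈ unitInterval := by
  refine ⟨div_nonneg (Nat.cast_nonneg _) (Nat.cast_nonneg _),
    div_le_one_of_le₀ ?_ (Nat.cast_nonneg _)⟩
  exact_mod_cast Finset.card_filter_le _ _

/-- The discretized confidence function obtained from `fB` and the calibration set `D` by running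
one instance of uniform-mass binning with `N` bins on each `D ∩ S_h`. -/
def umdConfidence {𝒳 ℋ : Type*} [DecidableEq ℋ] {n : ℕ} (fB : 𝒳 × ℋ → unitInterval) (N : ℕ)
    (D : Fin n → (𝒳 × ℋ) × Fin 2) : 𝒳 × ℋ → unitInterval := fun z =>
  ⟨umd (Finset.univ.filter (fun j => (D j).1.2 = z.2)) (fun j => (fB (D j).1 : ℝ))
      (fun j => (D j).2) N (fB z : ℝ), umd_mem _ _ _ _ _⟩

end UMD

end

end HumanAligned

/-!
Uniform-mass binning is analysed through deviation bounds for finitely many fixed events, without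
conditioning on the random bin edges.

Fix a slice `{H = h}` of mass `p` and cut it into cells by quantiles of the score, the cells having
mass `α p / (50 N)`. The count of a fixed event `A` in the sample differs from `n P(A)` by at most
`n (α / 200) max (P(A)) (p / N)` outside an event of probability `2 exp (- c n α² p / N)`
(`sampleCount_deviation`, a Chernoff bound). On the event that this holds for all bands between grid
points and for their parts with label `1`,

* every empirical edge `q_i` is trapped in a single grid cell (`umdEdge_between_edgeGrid`), so each
  bin is sandwiched between two bands of nearly equal mass;
* every bin contains at least `1 / N` of the samples of its slice (`card_div_le_card_umdBin`), so its
  mass is nearly `p / N` or more, and the errors above are errors relative to that mass;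
* hence the value of every bin is within `α / 2` of the conditional probability of the label `1`
  (`abs_measureReal_sub_umdValue_mul_le`).

Merging the bins with equal values, and then the slices, preserves this estimate, which gives
calibration on the whole space and, comparing two levels, alignment with error `α`. The exceptional
sets allowed by the definitions are not needed.

A union bound over the full grid would cost a factor `log (1 / α)`, absent from the required sample
size. But the empirical edge `q_i` stays within mass `α p / 50` of the ideal edge `i p / N`, already
by accuracy of the counts of lower bands; so only the `2 N + 1` grid points nearest to each ideal
edge are used, and the number of events is polynomial in `N` and linear in `|ℋ|`
(`union_bound_le`).
-/

open MeasureTheory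

namespace HumanAligned

/-! ### Deviation of counts in an i.i.d. sample -/

section Sampling

variable {Ω : Type*}

open Classical in
/-- The number of sample points that fall into `A`. -/
noncomputable def sampleCount {n : ℕ} (D : Fin n → Ω) (A : Set Ω) : ℕ :=
  (Finset.univ.filter (fun j => D j ∈ A)).card

theorem sampleCount_mono {n : ℕ} (D : Fin n → Ω) {A B : Set Ω} (h : A ⊆ B) :
    sampleCount D A ≤ sampleCount D B := by
  classical
  exact Finset.card_le_card (Finset.monotone_filter_right _ fun _ _ hj => h hj)

theorem sampleCount_eq_card {n : ℕ} (D : Fin n → Ω) {A : Set Ω} {J : Finset (Fin n)}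
    (h : ∀ j, j ∈ J ↔ D j ∈ A) : sampleCount D A = J.card := by
  classical
  unfold sampleCount
  congr 1
  ext j
  simp [h]

theorem sampleCount_eq_sum {n : ℕ} (D : Fin n → Ω) (A : Set Ω) :
    (sampleCount D A : ℝ) = ∑ j, A.indicator (fun _ => (1 : ℝ)) (D j) := by
  classical
  simp [sampleCount, Set.indicator_apply]

variable [MeasurableSpace Ω]

theorem integral_exp_indicator_le (P : Measure Ω) [IsProbabilityMeasure P] {A : Set Ω}
    (hA : MeasurableSet A) {θ : ℝ} (hθ : |θ| ≤ 1) :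
    ∫ w, Real.exp (θ * (A.indicator (fun _ => (1 : ℝ)) w - P.real A)) ∂P
      ≤ Real.exp (P.real A * θ ^ 2) := by
  have h1 : ∀ w, Real.exp (θ * (A.indicator (fun _ => (1 : ℝ)) w - P.real A))
      = Real.exp (-(θ * P.real A)) * (1 + A.indicator (fun _ => Real.exp θ - 1) w) := by
    intro w
    by_cases hw : w ∈ A
    · simp only [Set.indicator_of_mem hw]
      rw [mul_sub, mul_one, sub_eq_add_neg, Real.exp_add]
      ring
    · simp [Set.indicator_of_notMem hw]
  simp_rw [h1]
  rw [integral_const_mul, integral_add (integrable_const _)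
    ((integrable_const _).indicator hA), integral_indicator_const _ hA]
  have h2 : Real.exp θ - 1 ≤ θ + θ ^ 2 := by
    have := (abs_le.1 (Real.abs_exp_sub_one_sub_id_le hθ)).2
    linarith
  have hp : 0 ≤ P.real A := measureReal_nonneg
  have h3 : 1 + P.real A * (Real.exp θ - 1) ≤ Real.exp (P.real A * (θ + θ ^ 2)) := by
    have := Real.add_one_le_exp (P.real A * (θ + θ ^ 2))
    have := mul_le_mul_of_nonneg_left h2 hp
    linarith
  calc _ = Real.exp (-(θ * P.real A)) * (1 + P.real A * (Real.exp θ - 1)) := by simp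
    _ ≤ Real.exp (-(θ * P.real A)) * Real.exp (P.real A * (θ + θ ^ 2)) := by gcongr
    _ = _ := by rw [← Real.exp_add]; congr 1; ring

/-- The exponential Markov inequality for the centred count, with a tilt `θ` of either sign. -/
theorem tilted_sampleCount_tail (P : Measure Ω) [IsProbabilityMeasure P] {A : Set Ω}
    (hA : MeasurableSet A) {θ : ℝ} (hθ : |θ| ≤ 1) (n : ℕ) (c : ℝ) :
    (Measure.pi fun _ : Fin n => P).real
        {D | c ≤ θ * ((sampleCount D A : ℝ) - n * P.real A)}
      ≤ Real.exp (-c) * Real.exp (n * (P.real A * θ ^ 2)) := by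
  set X : Ω → ℝ := fun w => θ * (A.indicator (fun _ => (1 : ℝ)) w - P.real A) with hX
  have hXm : Measurable X := by
    have : Measurable (A.indicator (fun _ : Ω => (1 : ℝ))) := measurable_const.indicator hA
    fun_prop
  have hexp : ∀ D : Fin n → Ω, Real.exp (θ * ((sampleCount D A : ℝ) - n * P.real A))
      = ∏ j, Real.exp (X (D j)) := by
    intro D
    rw [← Real.exp_sum, sampleCount_eq_sum]
    simp [hX, ← Finset.mul_sum, Finset.sum_sub_distrib]
  have hXb : ∀ w, ‖Real.exp (X w)‖ ≤ Real.exp 1 * Real.exp 1 := by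
    intro w
    rw [Real.norm_eq_abs, Real.abs_exp, ← Real.exp_add]
    apply Real.exp_le_exp.2
    have hi : |A.indicator (fun _ => (1 : ℝ)) w - P.real A| ≤ 2 := by
      have h0 : 0 ≤ P.real A := measureReal_nonneg
      have h1 : P.real A ≤ 1 := measureReal_le_one
      by_cases hw : w ∈ A
      · rw [Set.indicator_of_mem hw, abs_le]; constructor <;> linarith
      · rw [Set.indicator_of_notMem hw, abs_le]; constructor <;> linarith
    calc X w ≤ |X w| := le_abs_self _
      _ = |θ| * |A.indicator (fun _ => (1 : ℝ)) w - P.real A| := abs_mul _ _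
      _ ≤ 1 * 2 := by gcongr
      _ = 1 + 1 := by norm_num
  have hXi : Integrable (fun w => Real.exp (X w)) P :=
    Integrable.of_bound hXm.exp.aestronglyMeasurable _ (Filter.Eventually.of_forall hXb)
  have hint : Integrable (fun D : Fin n → Ω => ∏ j, Real.exp (X (D j)))
      (Measure.pi fun _ : Fin n => P) :=
    Integrable.fintype_prod (f := fun _ w => Real.exp (X w)) fun _ => hXi
  have hmarkov := mul_meas_ge_le_integral_of_nonneg (μ := Measure.pi fun _ : Fin n => P)
    (Filter.Eventually.of_forall fun D => Finset.prod_nonneg fun j _ => (Real.exp_pos (X (D j))).le)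
    hint (Real.exp c)
  rw [integral_fintype_prod_eq_prod (fun _ w => Real.exp (X w))] at hmarkov
  have hset : {D : Fin n → Ω | c ≤ θ * ((sampleCount D A : ℝ) - n * P.real A)}
      = {D | Real.exp c ≤ ∏ j, Real.exp (X (D j))} := by
    ext D
    simp only [Set.mem_ofPred_eq]
    rw [← hexp, Real.exp_le_exp]
  rw [hset, Real.exp_neg, ← div_eq_inv_mul, le_div_iff₀ (Real.exp_pos _), mul_comm]
  refine hmarkov.trans ?_
  rw [Finset.prod_const, Finset.card_univ, Fintype.card_fin, Real.exp_nat_mul]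
  exact pow_le_pow_left₀ (integral_nonneg fun _ => (Real.exp_pos _).le)
    (integral_exp_indicator_le P hA hθ) n

/-- A two-sided Chernoff bound with the variance proxy `v`, in the regime `ε ≤ v` where the tail is
Gaussian. -/
theorem sampleCount_deviation (P : Measure Ω) [IsProbabilityMeasure P] {A : Set Ω}
    (hA : MeasurableSet A) {v ε : ℝ} (hv : P.real A ≤ v) (hv0 : 0 < v) (hε : 0 ≤ ε) (hεv : ε ≤ v)
    (n : ℕ) :
    (Measure.pi fun _ : Fin n => P).real
        {D | n * ε < |(sampleCount D A : ℝ) - n * P.real A|}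
      ≤ 2 * Real.exp (-(n * ε ^ 2 / (4 * v))) := by
  set θ : ℝ := ε / (2 * v) with hθ
  have hθ0 : 0 ≤ θ := by positivity
  have hθ1 : |θ| ≤ 1 := by
    rw [abs_of_nonneg hθ0, hθ, div_le_one (by positivity)]
    linarith
  have hbound : Real.exp (-(n * ε ^ 2 / (2 * v))) * Real.exp (n * (P.real A * θ ^ 2))
      ≤ Real.exp (-(n * ε ^ 2 / (4 * v))) := by
    rw [← Real.exp_add]
    apply Real.exp_le_exp.2
    have h1 : n * (P.real A * θ ^ 2) ≤ n * (v * θ ^ 2) := by gcongr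
    have h2 : n * (v * θ ^ 2) = n * ε ^ 2 / (4 * v) := by rw [hθ]; field_simp; norm_num
    have h3 : n * ε ^ 2 / (2 * v) = 2 * (n * ε ^ 2 / (4 * v)) := by field_simp; norm_num
    linarith
  have hsub : {D : Fin n → Ω | n * ε < |(sampleCount D A : ℝ) - n * P.real A|}
      ⊆ {D | n * ε ^ 2 / (2 * v) ≤ θ * ((sampleCount D A : ℝ) - n * P.real A)}
        ∪ {D | n * ε ^ 2 / (2 * v) ≤ (-θ) * ((sampleCount D A : ℝ) - n * P.real A)} := by
    intro D hD
    simp only [Set.mem_ofPred_eq, Set.mem_union] at hD ⊢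
    have hc : n * ε ^ 2 / (2 * v) = θ * (n * ε) := by rw [hθ]; field_simp
    rw [hc]
    rcases lt_abs.1 hD with h | h
    · exact Or.inl (mul_le_mul_of_nonneg_left h.le hθ0)
    · right
      have := mul_le_mul_of_nonneg_left h.le hθ0
      linarith
  have h1 := tilted_sampleCount_tail P hA hθ1 n (n * ε ^ 2 / (2 * v))
  have h2 := tilted_sampleCount_tail P hA (θ := -θ) (by rwa [abs_neg]) n (n * ε ^ 2 / (2 * v))
  rw [neg_sq] at h2
  calc _ ≤ _ := measureReal_mono hsub
    _ ≤ _ := measureReal_union_le _ _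
    _ ≤ _ := by linarith [h1.trans hbound, h2.trans hbound]

end Sampling

/-! ### Empirical quantiles and the bins of uniform-mass binning -/

section Bins

variable {ι : Type*} {J : Finset ι} {s : ι → ℝ}

theorem zero_mem_lowerBounds_quantile_set (hs : ∀ j, s j ∈ Set.Icc (0 : ℝ) 1) (hJ : J.Nonempty)
    {p : ℝ} (hp : 0 < p) :
    0 ∈ lowerBounds {t : ℝ | p * (J.card : ℝ) ≤ ((J.filter (fun j => s j ≤ t)).card : ℝ)} := by
  intro t ht
  by_contra! hlt
  have h0 : J.filter (fun j => s j ≤ t) = ∅ :=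
    Finset.filter_eq_empty_iff.2 fun j _ => not_le.2 (hlt.trans_le (hs j).1)
  have hJ' : (0 : ℝ) < J.card := by exact_mod_cast hJ.card_pos
  rw [Set.mem_ofPred_eq, h0] at ht
  simp only [Finset.card_empty, Nat.cast_zero] at ht
  exact absurd ht (not_le.2 (mul_pos hp hJ'))

theorem one_mem_quantile_set (hs : ∀ j, s j ∈ Set.Icc (0 : ℝ) 1) {p : ℝ} (hp : p ≤ 1) :
    (1 : ℝ) ∈ {t : ℝ | p * (J.card : ℝ) ≤ ((J.filter (fun j => s j ≤ t)).card : ℝ)} := by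
  have h0 : J.filter (fun j => s j ≤ 1) = J :=
    Finset.filter_true_of_mem fun j _ => (hs j).2
  rw [Set.mem_ofPred_eq, h0]
  exact mul_le_of_le_one_left (Nat.cast_nonneg _) hp

theorem empQuantile_le (hs : ∀ j, s j ∈ Set.Icc (0 : ℝ) 1) (hJ : J.Nonempty) {p t : ℝ}
    (hp : 0 < p) (ht : p * (J.card : ℝ) ≤ ((J.filter (fun j => s j ≤ t)).card : ℝ)) :
    empQuantile J s p ≤ t :=
  csInf_le ⟨0, zero_mem_lowerBounds_quantile_set hs hJ hp⟩ ht

theorem le_empQuantile (hs : ∀ j, s j ∈ Set.Icc (0 : ℝ) 1) {p t : ℝ}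
    (hp : p ≤ 1) (ht : ((J.filter (fun j => s j ≤ t)).card : ℝ) < p * (J.card : ℝ)) :
    t ≤ empQuantile J s p := by
  refine le_csInf ⟨1, one_mem_quantile_set hs hp⟩ fun u hu => ?_
  by_contra! hlt
  have : (J.filter (fun j => s j ≤ u)).card ≤ (J.filter (fun j => s j ≤ t)).card :=
    Finset.card_le_card (Finset.monotone_filter_right _ fun _ _ h => h.trans hlt.le)
  have : ((J.filter (fun j => s j ≤ u)).card : ℝ) ≤ ((J.filter (fun j => s j ≤ t)).card : ℝ) := by
    exact_mod_cast this
  exact absurd (lt_of_le_of_lt (le_trans hu this) ht) (lt_irrefl _)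

theorem empQuantile_mem_Icc (hs : ∀ j, s j ∈ Set.Icc (0 : ℝ) 1) (hJ : J.Nonempty) {p : ℝ}
    (hp : 0 < p) (hp1 : p ≤ 1) : empQuantile J s p ∈ Set.Icc (0 : ℝ) 1 :=
  ⟨le_csInf ⟨1, one_mem_quantile_set hs hp1⟩ (zero_mem_lowerBounds_quantile_set hs hJ hp),
    empQuantile_le hs hJ hp (one_mem_quantile_set hs hp1)⟩

theorem empQuantile_mono (hs : ∀ j, s j ∈ Set.Icc (0 : ℝ) 1) (hJ : J.Nonempty) {p p' : ℝ}
    (hp : 0 < p) (hpp : p ≤ p') (hp1 : p' ≤ 1) : empQuantile J s p ≤ empQuantile J s p' :=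
  csInf_le_csInf ⟨0, zero_mem_lowerBounds_quantile_set hs hJ hp⟩ ⟨1, one_mem_quantile_set hs hp1⟩
    fun _ ht => (mul_le_mul_of_nonneg_right hpp (Nat.cast_nonneg _)).trans ht

/-- The infimum defining the empirical quantile is attained: the empirical distribution function is
right-continuous. -/
theorem mul_card_le_card_le_empQuantile (hs : ∀ j, s j ∈ Set.Icc (0 : ℝ) 1) {p : ℝ} (hp : p ≤ 1) :
    p * (J.card : ℝ) ≤ ((J.filter (fun j => s j ≤ empQuantile J s p)).card : ℝ) := by
  set q := empQuantile J s p with hq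
  by_contra! hlt
  have hev : ∀ᶠ u in nhdsWithin q (Set.Ioi q), ∀ j ∈ J, s j ≤ u → s j ≤ q := by
    rw [Filter.eventually_all_finset]
    intro j _
    by_cases hj : s j ≤ q
    · exact Filter.Eventually.of_forall fun _ _ => hj
    · have := eventually_nhdsWithin_of_eventually_nhds (s := Set.Ioi q)
        (eventually_lt_nhds (not_le.1 hj))
      exact this.mono fun u hu h => absurd h (not_le.2 hu)
  obtain ⟨u, hu, hqu⟩ := (hev.and self_mem_nhdsWithin).exists
  have hqu' : q < u := hqu
  have hu' : u ≤ q := by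
    refine le_empQuantile hs hp (lt_of_le_of_lt ?_ hlt)
    exact_mod_cast Finset.card_le_card fun j hj => by
      rw [Finset.mem_filter] at hj ⊢
      exact ⟨hj.1, hu j hj.1 hj.2⟩
  exact absurd hqu' (not_lt.2 hu')

theorem card_lt_empQuantile_le (hs : ∀ j, s j ∈ Set.Icc (0 : ℝ) 1) (hJ : J.Nonempty) {p : ℝ}
    (hp : 0 < p) :
    ((J.filter (fun j => s j < empQuantile J s p)).card : ℝ) ≤ p * (J.card : ℝ) := by
  set q := empQuantile J s p with hq
  by_contra! hlt
  have hev : ∀ᶠ u in nhdsWithin q (Set.Iio q), ∀ j ∈ J, s j < q → s j ≤ u := by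
    rw [Filter.eventually_all_finset]
    intro j _
    by_cases hj : s j < q
    · have := eventually_nhdsWithin_of_eventually_nhds (s := Set.Iio q)
        (eventually_gt_nhds hj)
      exact this.mono fun u hu _ => le_of_lt hu
    · exact Filter.Eventually.of_forall fun _ h => absurd h hj
  obtain ⟨u, hu, hqu⟩ := (hev.and self_mem_nhdsWithin).exists
  have hqu' : u < q := hqu
  have hu' : q ≤ u := by
    refine empQuantile_le hs hJ hp (hlt.le.trans ?_)
    exact_mod_cast Finset.card_le_card fun j hj => by
      rw [Finset.mem_filter] at hj ⊢
      exact ⟨hj.1, hu j hj.1 hj.2⟩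
  exact absurd hqu' (not_lt.2 hu')

variable {N : ℕ}

theorem umdEdge_zero : umdEdge J s N 0 = 0 := by simp [umdEdge]

theorem umdEdge_self (hN : 0 < N) : umdEdge J s N N = 1 := by simp [umdEdge, hN.ne']

theorem umdEdge_inner {i : ℕ} (hi : 0 < i) (hiN : i < N) :
    umdEdge J s N i = empQuantile J s ((i : ℝ) / N) := by simp [umdEdge, hi.ne', hiN]

theorem div_mem_Ioc {i : ℕ} (hi : 0 < i) (hiN : i ≤ N) : (i : ℝ) / N ∈ Set.Ioc (0 : ℝ) 1 := by
  have hi' : (0 : ℝ) < i := by exact_mod_cast hi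
  have hN' : (0 : ℝ) < N := by exact_mod_cast hi.trans_le hiN
  exact ⟨by positivity, (div_le_one hN').2 (by exact_mod_cast hiN)⟩

theorem umdEdge_mem_Icc (hs : ∀ j, s j ∈ Set.Icc (0 : ℝ) 1) (hJ : J.Nonempty) (i : ℕ) :
    umdEdge J s N i ∈ Set.Icc (0 : ℝ) 1 := by
  rcases Nat.eq_zero_or_pos i with rfl | hi
  · simp [umdEdge_zero]
  · by_cases hiN : i < N
    · rw [umdEdge_inner hi hiN]
      exact empQuantile_mem_Icc hs hJ (div_mem_Ioc hi hiN.le).1 (div_mem_Ioc hi hiN.le).2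
    · simp [umdEdge, hi.ne', hiN]

theorem umdEdge_mono (hs : ∀ j, s j ∈ Set.Icc (0 : ℝ) 1) (hJ : J.Nonempty) :
    Monotone (umdEdge J s N) := by
  intro i k hik
  rcases Nat.eq_zero_or_pos i with rfl | hi
  · rw [umdEdge_zero]
    exact (umdEdge_mem_Icc hs hJ k).1
  · by_cases hkN : k < N
    · rw [umdEdge_inner hi (hik.trans_lt hkN), umdEdge_inner (hi.trans_le hik) hkN]
      refine empQuantile_mono hs hJ (div_mem_Ioc hi (hik.trans hkN.le)).1 ?_
        (div_mem_Ioc (hi.trans_le hik) hkN.le).2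
      gcongr
    · have : umdEdge J s N k = 1 := by simp [umdEdge, (hi.trans_le hik).ne', hkN]
      rw [this]
      exact (umdEdge_mem_Icc hs hJ i).2

theorem mul_card_le_card_le_umdEdge (hs : ∀ j, s j ∈ Set.Icc (0 : ℝ) 1) {i : ℕ}
    (hi : 0 < i) (hiN : i ≤ N) :
    (i : ℝ) / N * (J.card : ℝ) ≤ ((J.filter (fun j => s j ≤ umdEdge J s N i)).card : ℝ) := by
  rcases hiN.lt_or_eq with h | rfl
  · rw [umdEdge_inner hi h]
    exact mul_card_le_card_le_empQuantile hs (div_mem_Ioc hi hiN).2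
  · rw [umdEdge_self hi]
    exact one_mem_quantile_set hs (div_mem_Ioc hi le_rfl).2

theorem card_lt_umdEdge_le (hs : ∀ j, s j ∈ Set.Icc (0 : ℝ) 1) (hJ : J.Nonempty) {i : ℕ}
    (hiN : i < N) :
    ((J.filter (fun j => s j < umdEdge J s N i)).card : ℝ) ≤ (i : ℝ) / N * (J.card : ℝ) := by
  rcases Nat.eq_zero_or_pos i with rfl | hi
  · have : J.filter (fun j => s j < umdEdge J s N 0) = ∅ := by
      rw [umdEdge_zero]
      exact Finset.filter_eq_empty_iff.2 fun j _ => not_lt.2 (hs j).1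
    simp [this]
  · rw [umdEdge_inner hi hiN]
    exact card_lt_empQuantile_le hs hJ (div_mem_Ioc hi hiN.le).1

/-- Every bin receives at least its share `1 / N` of the samples. No absence of ties is needed,
because the bins are closed. -/
theorem card_div_le_card_umdBin (hs : ∀ j, s j ∈ Set.Icc (0 : ℝ) 1) (hJ : J.Nonempty) {i : ℕ}
    (hiN : i < N) : (J.card : ℝ) / N ≤ ((umdBin J s N i).card : ℝ) := by
  classical
  have h1 := mul_card_le_card_le_umdEdge (J := J) hs (Nat.succ_pos i) (Nat.succ_le_of_lt hiN)
  have h2 := card_lt_umdEdge_le hs hJ hiN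
  have hsub : J.filter (fun j => s j ≤ umdEdge J s N (i + 1))
      ⊆ J.filter (fun j => s j < umdEdge J s N i) ∪ umdBin J s N i := by
    intro j hj
    simp only [Finset.mem_filter, Finset.mem_union, umdBin, Set.mem_Icc] at hj ⊢
    rcases lt_or_ge (s j) (umdEdge J s N i) with h | h
    · exact Or.inl ⟨hj.1, h⟩
    · exact Or.inr ⟨hj.1, h, hj.2⟩
  have h3 : ((J.filter (fun j => s j ≤ umdEdge J s N (i + 1))).card : ℝ)
      ≤ ((J.filter (fun j => s j < umdEdge J s N i)).card : ℝ) + ((umdBin J s N i).card : ℝ) := by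
    exact_mod_cast (Finset.card_le_card hsub).trans (Finset.card_union_le _ _)
  have h4 : ((i.succ : ℕ) : ℝ) / N * (J.card : ℝ)
      = (i : ℝ) / N * (J.card : ℝ) + (J.card : ℝ) / N := by push_cast; ring
  rw [h4] at h1
  have h5 : ((J.filter (fun j => s j ≤ umdEdge J s N i.succ)).card : ℝ)
    = ((J.filter (fun j => s j ≤ umdEdge J s N (i + 1))).card : ℝ) := rfl
  linarith

theorem umdIndex_lt (hN : 0 < N) (t : ℝ) : umdIndex J s N t < N := by
  have h : umdIndex J s N t ≤ (Finset.Ico 1 N).card := Finset.card_filter_le _ _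
  rw [Nat.card_Ico] at h
  omega

theorem umdIndex_of_mem_Ioc (hs : ∀ j, s j ∈ Set.Icc (0 : ℝ) 1) (hJ : J.Nonempty) {i : ℕ}
    (hiN : i < N) {t : ℝ} (ht : t ∈ Set.Ioc (umdEdge J s N i) (umdEdge J s N (i + 1))) :
    umdIndex J s N t = i := by
  have : (Finset.Ico 1 N).filter (fun k => umdEdge J s N k < t) = Finset.Ico 1 (i + 1) := by
    ext k
    simp only [Finset.mem_filter, Finset.mem_Ico]
    constructor
    · rintro ⟨⟨h1, h2⟩, h3⟩
      refine ⟨h1, ?_⟩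
      by_contra! h
      exact absurd (ht.2.trans (umdEdge_mono hs hJ h)) (not_le.2 h3)
    · rintro ⟨h1, h2⟩
      exact ⟨⟨h1, by omega⟩, (umdEdge_mono hs hJ (by omega : k ≤ i)).trans_lt ht.1⟩
  simp [umdIndex, this]

theorem mem_Icc_of_umdIndex (hs : ∀ j, s j ∈ Set.Icc (0 : ℝ) 1) (hJ : J.Nonempty) (hN : 0 < N)
    {t : ℝ} (ht : t ∈ Set.Icc (0 : ℝ) 1) :
    t ∈ Set.Icc (umdEdge J s N (umdIndex J s N t)) (umdEdge J s N (umdIndex J s N t + 1)) := by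
  rcases eq_or_lt_of_le ht.1 with h0 | h0
  · have : umdIndex J s N t = 0 := by
      simp only [umdIndex, Finset.card_eq_zero]
      refine Finset.filter_eq_empty_iff.2 fun k _ => not_lt.2 ?_
      rw [← h0]
      exact (umdEdge_mem_Icc hs hJ k).1
    rw [this, umdEdge_zero]
    exact ⟨ht.1, h0 ▸ (umdEdge_mem_Icc hs hJ _).1⟩
  · -- a positive score lies in one of the half-open bins, and that bin has its index
    have hex : ∃ i, t ≤ umdEdge J s N i := ⟨N, by rw [umdEdge_self hN]; exact ht.2⟩
    classical
    set k := Nat.find hex with hk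
    have hkpos : 0 < k := by
      rw [hk, Nat.find_pos, umdEdge_zero]
      exact not_le.2 h0
    have hkN : k ≤ N := Nat.find_min' hex (by rw [umdEdge_self hN]; exact ht.2)
    have h1 : umdEdge J s N (k - 1) < t := not_le.1 (Nat.find_min hex (by omega))
    have h2 : t ≤ umdEdge J s N (k - 1 + 1) := by
      rw [Nat.sub_add_cancel hkpos]
      exact Nat.find_spec hex
    rw [umdIndex_of_mem_Ioc hs hJ (by omega : k - 1 < N) ⟨h1, h2⟩]
    exact ⟨h1.le, h2⟩

end Bins

/-! ### Score bands and population quantiles -/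

section Quantiles

variable {Ω : Type*}

/-- The part of the slice `E` on which the score `g` lies in `[a, b]`. -/
def band (E : Set Ω) (g : Ω → ℝ) (a b : ℝ) : Set Ω := E ∩ g ⁻¹' Set.Icc a b

theorem band_zero_one (E : Set Ω) {g : Ω → ℝ} (hg : ∀ w, g w ∈ Set.Icc (0 : ℝ) 1) :
    band E g 0 1 = E := by
  ext w
  simp only [band, Set.mem_inter_iff, Set.mem_preimage, hg w, and_true]

theorem band_mono (E : Set Ω) (g : Ω → ℝ) {a a' b b' : ℝ} (ha : a ≤ a') (hb : b' ≤ b) :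
    band E g a' b' ⊆ band E g a b :=
  Set.inter_subset_inter_right _ (Set.preimage_mono (Set.Icc_subset_Icc ha hb))

/-- This inclusion needs no ordering of the four endpoints. -/
theorem band_subset_union (E : Set Ω) (g : Ω → ℝ) (a a' b b' : ℝ) :
    band E g a b' ⊆ band E g a' b ∪ (band E g a a' ∪ band E g b b') := by
  rintro w ⟨hE, h1, h2⟩
  rcases le_or_gt (g w) a' with h | h
  · exact Or.inr (Or.inl ⟨hE, h1, h⟩)
  · rcases le_or_gt (g w) b with h' | h'
    · exact Or.inl ⟨hE, h.le, h'⟩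
    · exact Or.inr (Or.inr ⟨hE, h'.le, h2⟩)

variable [MeasurableSpace Ω]

theorem measurableSet_band {E : Set Ω} {g : Ω → ℝ} (hE : MeasurableSet E) (hg : Measurable g)
    (a b : ℝ) : MeasurableSet (band E g a b) := hE.inter (hg measurableSet_Icc)

theorem measureReal_band_self (P : Measure Ω) (E : Set Ω) {g : Ω → ℝ}
    (hatom : ∀ u, P (g ⁻¹' {u}) = 0) (a : ℝ) : P.real (band E g a a) = 0 := by
  have : band E g a a ⊆ g ⁻¹' {a} := fun w hw => le_antisymm hw.2.2 hw.2.1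
  simp [Measure.real, measure_mono_null this (hatom a)]

/-- `t` is a quantile function of the score `g` on the slice `E`, parametrized by mass and extended
to all real masses by truncation. -/
structure IsQuantileMap (P : Measure Ω) (E : Set Ω) (g : Ω → ℝ) (t : ℝ → ℝ) : Prop where
  mem_Icc : ∀ v, t v ∈ Set.Icc (0 : ℝ) 1
  eq_zero : ∀ v, v ≤ 0 → t v = 0
  eq_one : ∀ v, 0 < v → P.real E ≤ v → t v = 1
  mass : ∀ v, P.real (band E g 0 (t v)) = max 0 (min v (P.real E))

theorem continuousOn_measureReal_band (P : Measure Ω) [IsProbabilityMeasure P] {E : Set Ω}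
    {g : Ω → ℝ} (hg : Measurable g) (hatom : ∀ u, P (g ⁻¹' {u}) = 0) :
    ContinuousOn (fun u => P.real (band E g 0 u)) (Set.Icc 0 1) := by
  set ν : Measure ℝ := (P.restrict E).map g with hν
  have : NullSingletonClass ν := ⟨fun u => by
    rw [hν, Measure.map_apply hg (measurableSet_singleton u)]
    exact le_antisymm ((Measure.restrict_apply_le _ _).trans_eq (hatom u)) bot_le⟩
  have hfin : IsFiniteMeasure ν := by rw [hν]; infer_instance
  have hcont : Continuous fun u => ∫ _ in (0 : ℝ)..u, (1 : ℝ) ∂ν :=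
    intervalIntegral.continuous_primitive (fun _ _ => intervalIntegrable_const) 0
  refine hcont.continuousOn.congr fun u hu => ?_
  change _ = ∫ _ in (0 : ℝ)..u, (1 : ℝ) ∂ν
  rw [intervalIntegral.integral_of_le hu.1, setIntegral_const, smul_eq_mul, mul_one, measureReal_def,
    measureReal_def, ← measure_congr (Ioc_ae_eq_Icc (μ := ν) (a := (0 : ℝ)) (b := u)).symm, hν,
    Measure.map_apply hg measurableSet_Icc, Measure.restrict_apply (hg measurableSet_Icc),
    Set.inter_comm]
  rfl

theorem exists_isQuantileMap (P : Measure Ω) [IsProbabilityMeasure P] {E : Set Ω} {g : Ω → ℝ}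
    (hg : Measurable g) (hg01 : ∀ w, g w ∈ Set.Icc (0 : ℝ) 1)
    (hatom : ∀ u, P (g ⁻¹' {u}) = 0) : ∃ t, IsQuantileMap P E g t := by
  have hcont := continuousOn_measureReal_band P (E := E) hg hatom
  have hivt := intermediate_value_Icc zero_le_one hcont
  simp only [measureReal_band_self P E hatom, band_zero_one E hg01] at hivt
  have hex : ∀ v : ℝ, ∃ u, u ∈ Set.Icc (0 : ℝ) 1 ∧ (v ≤ 0 → u = 0) ∧
      (0 < v → P.real E ≤ v → u = 1) ∧ P.real (band E g 0 u) = max 0 (min v (P.real E)) := by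
    intro v
    have hE0 : 0 ≤ P.real E := measureReal_nonneg
    rcases le_or_gt v 0 with h0 | h0
    · refine ⟨0, by simp, fun _ => rfl, fun h => absurd h (not_lt.2 h0), ?_⟩
      rw [measureReal_band_self P E hatom, max_eq_left ((min_le_left _ _).trans h0)]
    · rcases le_or_gt (P.real E) v with h1 | h1
      · refine ⟨1, by simp, fun h => absurd h0 (not_lt.2 h), fun _ _ => rfl, ?_⟩
        rw [band_zero_one E hg01, min_eq_right h1, max_eq_right hE0]
      · obtain ⟨u, hu, huv⟩ := hivt ⟨h0.le, h1.le⟩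
        refine ⟨u, hu, fun h => absurd h0 (not_lt.2 h), fun _ h => absurd h1 (not_lt.2 h), ?_⟩
        rw [min_eq_left h1.le, max_eq_right h0.le]
        exact huv
  choose t ht using hex
  exact ⟨t, fun v => (ht v).1, fun v => (ht v).2.1, fun v => (ht v).2.2.1, fun v => (ht v).2.2.2⟩

theorem IsQuantileMap.measureReal_band_le {P : Measure Ω} [IsProbabilityMeasure P] {E : Set Ω}
    {g : Ω → ℝ} {t : ℝ → ℝ} (ht : IsQuantileMap P E g t) (hE : MeasurableSet E) (hg : Measurable g)
    (hatom : ∀ u, P (g ⁻¹' {u}) = 0) {v v' : ℝ} (hv : v ≤ v') :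
    P.real (band E g (t v) (t v')) ≤ v' - v := by
  rcases lt_or_ge (t v') (t v) with h | h
  · simp [band, Set.Icc_eq_empty (not_le.2 h), sub_nonneg.2 hv]
  · have hsub : band E g (t v) (t v')
        ⊆ (band E g 0 (t v') \ band E g 0 (t v)) ∪ band E g (t v) (t v) := by
      rintro w ⟨hwE, h1, h2⟩
      rcases h1.eq_or_lt with h' | h'
      · exact Or.inr ⟨hwE, h1, h'.ge⟩
      · exact Or.inl ⟨⟨hwE, (ht.mem_Icc v).1.trans h1, h2⟩, fun hw => absurd hw.2.2 (not_le.2 h')⟩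
    have h1 := (measureReal_mono (μ := P) hsub).trans (measureReal_union_le _ _)
    rw [measureReal_band_self P E hatom, add_zero,
      measureReal_sdiff (band_mono E g le_rfl h) (measurableSet_band hE hg _ _), ht.mass, ht.mass]
      at h1
    refine h1.trans ?_
    rcases max_cases 0 (min v' (P.real E)) with ⟨h2, _⟩ | ⟨h2, _⟩ <;>
    rcases max_cases 0 (min v (P.real E)) with ⟨h3, _⟩ | ⟨h3, _⟩ <;>
    rcases min_cases v' (P.real E) with ⟨h4, _⟩ | ⟨h4, _⟩ <;>
    rcases min_cases v (P.real E) with ⟨h5, _⟩ | ⟨h5, _⟩ <;> rw [h2, h3] <;> linarith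

end Quantiles

/-! ### Localization of the empirical bin edges on a grid of population quantiles -/

section Grid

variable {Ω : Type*}

/-- A finite set of quantiles: around the mass `p i / N` of the ideal `i`-th bin edge, masses spaced
by `α p / (50 N)` up to distance `α p / 50`. Its size depends on `N` only, not on `α`. -/
noncomputable def edgeGrid (t : ℝ → ℝ) (p α : ℝ) (N : ℕ) : Finset ℝ :=
  (Finset.range (N + 1) ×ˢ Finset.range (2 * N + 1)).image
    fun x => t (p * x.1 / N + ((x.2 : ℝ) - N) * (α * p / (50 * N)))

theorem card_edgeGrid_le (t : ℝ → ℝ) (p α : ℝ) (N : ℕ) :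
    (edgeGrid t p α N).card ≤ (N + 1) * (2 * N + 1) := by
  refine Finset.card_image_le.trans ?_
  simp

theorem mem_edgeGrid (t : ℝ → ℝ) (p α : ℝ) {N i k : ℕ} (hi : i ≤ N) (hk : k ≤ 2 * N) :
    t (p * i / N + ((k : ℝ) - N) * (α * p / (50 * N))) ∈ edgeGrid t p α N :=
  Finset.mem_image.2 ⟨(i, k), by simp; omega, rfl⟩

variable [MeasurableSpace Ω]

/-- The empirical count of `A` is accurate, with relative error `α / 200` if `A` has at least the
mass `q`, and with the error permitted at mass `q` otherwise. -/
def IsAccurate (P : Measure Ω) {n : ℕ} (D : Fin n → Ω) (α q : ℝ) (A : Set Ω) : Prop :=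
  |(sampleCount D A : ℝ) - n * P.real A| ≤ n * (α / 200 * max (P.real A) q)

/-- A discrete intermediate value property; `f` need not be monotone. -/
theorem exists_step_of_between (f : ℕ → ℝ) (q : ℝ) {m : ℕ} (hm : 0 < m) (h0 : f 0 ≤ q)
    (h1 : q ≤ f m) : ∃ k < m, f k ≤ q ∧ q ≤ f (k + 1) := by
  induction m, Nat.succ_le_of_lt hm using Nat.le_induction with
  | base => exact ⟨0, one_pos, h0, h1⟩
  | succ m hm' ih =>
    rcases le_total (f m) q with h | h
    · exact ⟨m, Nat.lt_succ_self m, h, h1⟩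
    · obtain ⟨k, hk, hk'⟩ := ih hm' h
      exact ⟨k, hk.trans (Nat.lt_succ_self m), hk'⟩

/-- If all bands between grid points have accurate counts, then every empirical bin edge lies in a
grid cell of mass at most `α p / (50 N)`. -/
theorem umdEdge_between_edgeGrid {P : Measure Ω} [IsProbabilityMeasure P] {E : Set Ω} {g : Ω → ℝ}
    {t : ℝ → ℝ} (ht : IsQuantileMap P E g t) (hE : MeasurableSet E) (hg : Measurable g)
    (hg01 : ∀ w, g w ∈ Set.Icc (0 : ℝ) 1) (hatom : ∀ u, P (g ⁻¹' {u}) = 0) (hp : 0 < P.real E)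
    {α : ℝ} (hα : 0 < α) {N n : ℕ} (hN : 0 < N) (hn : 0 < n)
    {D : Fin n → Ω} {J : Finset (Fin n)} (hJ : ∀ j, j ∈ J ↔ D j ∈ E) (hJne : J.Nonempty)
    (hacc : ∀ a ∈ edgeGrid t (P.real E) α N, ∀ b ∈ edgeGrid t (P.real E) α N,
      IsAccurate P D α (P.real E / N) (band E g a b)) {i : ℕ} (hi : i ≤ N) :
    ∃ a ∈ edgeGrid t (P.real E) α N, ∃ b ∈ edgeGrid t (P.real E) α N,
      a ≤ umdEdge J (fun j => g (D j)) N i ∧ umdEdge J (fun j => g (D j)) N i ≤ b ∧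
      P.real (band E g a b) ≤ α * P.real E / (50 * N) := by
  set p := P.real E with hpdef
  have hN' : (0 : ℝ) < N := by exact_mod_cast hN
  have hn' : (0 : ℝ) < n := by exact_mod_cast hn
  have hs : ∀ j, g (D j) ∈ Set.Icc (0 : ℝ) 1 := fun j => hg01 _
  have hρ : 0 ≤ α * p / (50 * N) := by positivity
  have h0mem : (0 : ℝ) ∈ edgeGrid t p α N := by
    have := mem_edgeGrid t p α (Nat.zero_le N) (by omega : N ≤ 2 * N)
    simpa [ht.eq_zero 0 le_rfl] using this
  have h1mem : (1 : ℝ) ∈ edgeGrid t p α N := by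
    have := mem_edgeGrid t p α (le_refl N) (by omega : N ≤ 2 * N)
    rwa [sub_self, zero_mul, add_zero, mul_div_cancel_right₀ _ hN'.ne', ht.eq_one p hp le_rfl]
      at this
  rcases Nat.eq_zero_or_pos i with rfl | hi0
  · refine ⟨0, h0mem, 0, h0mem, ?_, ?_, ?_⟩
    · rw [umdEdge_zero]
    · rw [umdEdge_zero]
    · rw [measureReal_band_self P E hatom]; exact hρ
  rcases hi.eq_or_lt with rfl | hiN
  · refine ⟨1, h1mem, 1, h1mem, ?_, ?_, ?_⟩
    · rw [umdEdge_self hi0]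
    · rw [umdEdge_self hi0]
    · rw [measureReal_band_self P E hatom]; exact hρ
  set τ : ℕ → ℝ := fun k => t (p * i / N + ((k : ℝ) - N) * (α * p / (50 * N))) with hτ
  have hτmem : ∀ k ≤ 2 * N, τ k ∈ edgeGrid t p α N := fun k hk => mem_edgeGrid t p α hi hk
  have hpN : p / N ≤ p := div_le_self hp.le (by exact_mod_cast hN)
  -- counts of the lower bands `[0, u]` have error at most `α p / 200`
  have hlow : ∀ u ∈ edgeGrid t p α N,
      |((J.filter (fun j => g (D j) ≤ u)).card : ℝ) - n * P.real (band E g 0 u)|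
        ≤ n * (α / 200 * p) := by
    intro u hu
    have h1 := hacc 0 h0mem u hu
    have hc : sampleCount D (band E g 0 u) = (J.filter (fun j => g (D j) ≤ u)).card := by
      refine sampleCount_eq_card D fun j => ?_
      simp [band, hJ, (hs j).1]
    rw [IsAccurate, hc] at h1
    refine h1.trans ?_
    have : max (P.real (band E g 0 u)) (p / N) ≤ p :=
      max_le (measureReal_mono Set.inter_subset_left) hpN
    gcongr
  have hm : |(J.card : ℝ) - n * p| ≤ n * (α / 200 * p) := by
    have h1 := hlow 1 h1mem
    rwa [Finset.filter_true_of_mem fun j _ => (hs j).2, band_zero_one E hg01] at h1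
  have hr := div_mem_Ioc hi0 hiN.le
  set r : ℝ := (i : ℝ) / N with hrdef
  have hpr : p * i / N = p * r := by rw [hrdef, mul_div_assoc]
  have hδ : (N : ℝ) * (α * p / (50 * N)) = α * p / 50 := by field_simp
  have hnap : 0 < n * (α * p) := by positivity
  have hm1 : r * (J.card : ℝ) ≤ n * (p * r) + n * (α / 200 * p) := by
    have h1 := mul_le_mul_of_nonneg_left (abs_le.1 hm).2 hr.1.le
    have h2 : r * (n * (α / 200 * p)) ≤ n * (α / 200 * p) :=
      mul_le_of_le_one_left (by positivity) hr.2
    linarith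
  have hm2 : n * (p * r) - n * (α / 200 * p) ≤ r * (J.card : ℝ) := by
    have h1 := mul_le_mul_of_nonneg_left (abs_le.1 hm).1 hr.1.le
    have h2 : r * (n * (α / 200 * p)) ≤ n * (α / 200 * p) :=
      mul_le_of_le_one_left (by positivity) hr.2
    linarith
  have hlo : τ 0 ≤ umdEdge J (fun j => g (D j)) N i := by
    have harg : p * i / N + (((0 : ℕ) : ℝ) - N) * (α * p / (50 * N)) = p * r - α * p / 50 := by
      rw [hpr, Nat.cast_zero, zero_sub, neg_mul, hδ]; ring
    have hτ0 : τ 0 = t (p * r - α * p / 50) := by rw [hτ]; simp only [harg]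
    rcases le_or_gt (p * r - α * p / 50) 0 with h | h
    · rw [hτ0, ht.eq_zero _ h]
      exact (umdEdge_mem_Icc hs hJne i).1
    · rw [umdEdge_inner hi0 hiN]
      refine le_empQuantile hs hr.2 ?_
      have h1 := (abs_le.1 (hlow _ (hτmem 0 (Nat.zero_le _)))).2
      have h2 : P.real (band E g 0 (τ 0)) ≤ p * r - α * p / 50 := by
        rw [hτ0, ht.mass]
        exact max_le h.le (min_le_left _ _)
      have h3 := mul_le_mul_of_nonneg_left h2 hn'.le
      linarith
  have hhi : umdEdge J (fun j => g (D j)) N i ≤ τ (2 * N) := by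
    have harg : p * i / N + (((2 * N : ℕ) : ℝ) - N) * (α * p / (50 * N)) = p * r + α * p / 50 := by
      rw [hpr, ← hδ]; push_cast; ring
    have hτ1 : τ (2 * N) = t (p * r + α * p / 50) := by rw [hτ]; simp only [harg]
    have hpos : 0 < p * r + α * p / 50 := by have := hr.1; positivity
    rcases le_or_gt p (p * r + α * p / 50) with h | h
    · rw [hτ1, ht.eq_one _ hpos h]
      exact (umdEdge_mem_Icc hs hJne i).2
    · rw [umdEdge_inner hi0 hiN]
      refine empQuantile_le hs hJne hr.1 ?_
      have h1 := (abs_le.1 (hlow _ (hτmem (2 * N) le_rfl))).1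
      have h2 : p * r + α * p / 50 ≤ P.real (band E g 0 (τ (2 * N))) := by
        rw [hτ1, ht.mass]
        exact (le_min le_rfl h.le).trans (le_max_right _ _)
      have h3 := mul_le_mul_of_nonneg_left h2 hn'.le
      linarith
  obtain ⟨k, hk, hk1, hk2⟩ := exists_step_of_between τ _ (by omega : 0 < 2 * N) hlo hhi
  refine ⟨τ k, hτmem k hk.le, τ (k + 1), hτmem (k + 1) hk, hk1, hk2, ?_⟩
  refine (ht.measureReal_band_le hE hg hatom ?_).trans_eq ?_
  · push_cast
    have : ((k : ℝ) - N) * (α * p / (50 * N)) ≤ ((k : ℝ) + 1 - N) * (α * p / (50 * N)) :=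
      mul_le_mul_of_nonneg_right (by linarith) hρ
    linarith
  · push_cast
    ring

end Grid

/-! ### Accuracy of the bin values -/

section BinValue

variable {Ω : Type*} [MeasurableSpace Ω]

/-- If the conditional frequencies `x₁ / x` and `X₁ / X` have close numerators and denominators,
relative to `x`, then they are close. -/
theorem abs_sub_div_mul_le {x x₁ X X₁ e : ℝ} (h : |x - X| ≤ e) (h₁ : |x₁ - X₁| ≤ e) (hX : 0 < X)
    (hX₁ : 0 ≤ X₁) (hle : X₁ ≤ X) : |x₁ - X₁ / X * x| ≤ 2 * e := by
  have hr : |X₁ / X| ≤ 1 := by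
    rw [abs_of_nonneg (by positivity)]
    exact (div_le_one hX).2 hle
  have hid : x₁ - X₁ / X * x = (x₁ - X₁) - X₁ / X * (x - X) := by field_simp; ring
  rw [hid]
  calc |(x₁ - X₁) - X₁ / X * (x - X)| ≤ |x₁ - X₁| + |X₁ / X * (x - X)| := abs_sub _ _
    _ ≤ e + 1 * e := by
      rw [abs_mul]
      gcongr
    _ = 2 * e := by ring

/-- A set `S` and a count `X` that are both sandwiched between an inner set `A` and an outer set `B`
with accurate counts agree up to the mass `ρ` of the gap and the permitted error. -/
theorem abs_measureReal_sub_le_of_sandwich {P : Measure Ω} [IsProbabilityMeasure P] {n : ℕ}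
    (hn : 0 < n) {D : Fin n → Ω} {α q M ρ x X : ℝ} (hα : 0 ≤ α) {A B : Set Ω}
    (hA : IsAccurate P D α q A) (hB : IsAccurate P D α q B) (hAB : P.real A ≤ P.real B)
    (hgap : P.real B ≤ P.real A + ρ) (hBM : P.real B ≤ M) (hqM : q ≤ M)
    (hAx : P.real A ≤ x) (hxB : x ≤ P.real B)
    (hAX : (sampleCount D A : ℝ) ≤ X) (hXB : X ≤ (sampleCount D B : ℝ)) :
    |x - X / n| ≤ ρ + α / 200 * M := by
  have hn' : (0 : ℝ) < n := by exact_mod_cast hn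
  have hmA : max (P.real A) q ≤ M := max_le (hAB.trans hBM) hqM
  have hmB : max (P.real B) q ≤ M := max_le hBM hqM
  have h1 : n * (P.real A - α / 200 * M) ≤ X := by
    have h2 := (abs_le.1 hA).1
    have h3 : n * (α / 200 * max (P.real A) q) ≤ n * (α / 200 * M) := by gcongr
    linarith
  have h2 : X ≤ n * (P.real B + α / 200 * M) := by
    have h2 := (abs_le.1 hB).2
    have h3 : n * (α / 200 * max (P.real B) q) ≤ n * (α / 200 * M) := by gcongr
    linarith
  rw [← le_div_iff₀' hn'] at h1
  rw [← div_le_iff₀' hn'] at h2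
  rw [abs_le]
  constructor <;> linarith

/-- If the bands between grid points, and their parts with label `1`, have accurate counts, then the
value of each bin is within `α / 2` of the conditional probability of the label `1` on that bin. -/
theorem abs_measureReal_sub_umdValue_mul_le {P : Measure Ω} [IsProbabilityMeasure P]
    {E F : Set Ω} {g : Ω → ℝ} {t : ℝ → ℝ} (ht : IsQuantileMap P E g t) (hE : MeasurableSet E)
    (hg : Measurable g) (hg01 : ∀ w, g w ∈ Set.Icc (0 : ℝ) 1) (hatom : ∀ u, P (g ⁻¹' {u}) = 0)
    (hp : 0 < P.real E) {α : ℝ} (hα : 0 < α) (hα1 : α ≤ 1) {N n : ℕ} (hN : 0 < N) (hn : 0 < n)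
    {D : Fin n → Ω} {J : Finset (Fin n)} (hJ : ∀ j, j ∈ J ↔ D j ∈ E)
    {y : Fin n → Fin 2} (hy : ∀ j, y j = 1 ↔ D j ∈ F)
    (hacc : ∀ a ∈ edgeGrid t (P.real E) α N, ∀ b ∈ edgeGrid t (P.real E) α N,
      IsAccurate P D α (P.real E / N) (band E g a b))
    (haccF : ∀ a ∈ edgeGrid t (P.real E) α N, ∀ b ∈ edgeGrid t (P.real E) α N,
      IsAccurate P D α (P.real E / N) (band E g a b ∩ F)) {i : ℕ} (hi : i < N) :
    |P.real ({w ∈ E | umdIndex J (fun j => g (D j)) N (g w) = i} ∩ F)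
        - umdValue J (fun j => g (D j)) y N i
          * P.real {w ∈ E | umdIndex J (fun j => g (D j)) N (g w) = i}|
      ≤ α / 2 * P.real {w ∈ E | umdIndex J (fun j => g (D j)) N (g w) = i} := by
  classical
  set p := P.real E with hpdef
  have hN' : (0 : ℝ) < N := by exact_mod_cast hN
  have hn' : (0 : ℝ) < n := by exact_mod_cast hn
  have hs : ∀ j, g (D j) ∈ Set.Icc (0 : ℝ) 1 := fun j => hg01 _
  -- the whole slice is the band `[0, 1]`, so the size of `J` is controlled
  have hm : (1 - α / 200) * (n * p) ≤ (J.card : ℝ) := by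
    have h0 := mem_edgeGrid t p α (Nat.zero_le N) (by omega : N ≤ 2 * N)
    have h1 := mem_edgeGrid t p α (le_refl N) (by omega : N ≤ 2 * N)
    rw [sub_self, zero_mul, add_zero, Nat.cast_zero, mul_zero, zero_div, ht.eq_zero _ le_rfl] at h0
    rw [sub_self, zero_mul, add_zero, mul_div_cancel_right₀ _ hN'.ne', ht.eq_one p hp le_rfl] at h1
    have h2 := hacc 0 h0 1 h1
    rw [band_zero_one E hg01, IsAccurate, sampleCount_eq_card D hJ, ← hpdef,
      max_eq_left (div_le_self hp.le (by exact_mod_cast hN))] at h2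
    have := (abs_le.1 h2).1
    linarith
  have hJne : J.Nonempty := by
    rw [← Finset.card_pos]
    have : (0 : ℝ) < (1 - α / 200) * (n * p) := mul_pos (by linarith) (by positivity)
    exact_mod_cast this.trans_le hm
  obtain ⟨a, ha, a', ha', haq, hqa, hρa⟩ :=
    umdEdge_between_edgeGrid ht hE hg hg01 hatom hp hα hN hn hJ hJne hacc hi.le
  obtain ⟨b, hb, b', hb', hbq, hqb, hρb⟩ :=
    umdEdge_between_edgeGrid ht hE hg hg01 hatom hp hα hN hn hJ hJne hacc (Nat.succ_le_of_lt hi)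
  rw [← hpdef] at hρa hρb
  rw [Nat.succ_eq_add_one] at hbq hqb
  set s : Fin n → ℝ := fun j => g (D j) with hsdef
  set q := umdEdge J s N i
  set q' := umdEdge J s N (i + 1)
  set S : Set Ω := {w ∈ E | umdIndex J s N (g w) = i} with hS
  set ρ := α * p / (50 * N) with hρ
  set M := max (P.real (band E g a b')) (p / N) with hM
  have hSq : S ⊆ band E g q q' := by
    rintro w ⟨hwE, hwi⟩
    have := mem_Icc_of_umdIndex hs hJne hN (hg01 w)
    rw [hwi] at this
    exact ⟨hwE, this⟩
  have hqS : band E g q q' ⊆ S ∪ band E g q q := by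
    rintro w ⟨hwE, h1, h2⟩
    rcases h1.eq_or_lt with h | h
    · exact Or.inr ⟨hwE, h1, h.ge⟩
    · exact Or.inl ⟨hwE, umdIndex_of_mem_Ioc hs hJne hi ⟨h, h2⟩⟩
  have hinout : band E g a' b ⊆ band E g a b' := band_mono E g (haq.trans hqa) (hbq.trans hqb)
  -- the sandwich estimate on the part of the bin in an arbitrary set `G`, for `G = Ω` and `G = F`
  have key : ∀ G : Set Ω, IsAccurate P D α (p / N) (band E g a' b ∩ G) →
      IsAccurate P D α (p / N) (band E g a b' ∩ G) →
      |P.real (S ∩ G) - (sampleCount D (band E g q q' ∩ G) : ℝ) / n| ≤ 2 * ρ + α / 200 * M := by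
    intro G h1 h2
    refine abs_measureReal_sub_le_of_sandwich hn hα.le h1 h2
      (measureReal_mono (Set.inter_subset_inter_left _ hinout)) ?_
      ((measureReal_mono Set.inter_subset_left).trans (le_max_left _ _)) (le_max_right _ _)
      ?_ (measureReal_mono (Set.inter_subset_inter_left _
        (hSq.trans (band_mono E g haq hqb)))) ?_ ?_
    · have hsub : band E g a b' ∩ G
          ⊆ (band E g a' b ∩ G) ∪ (band E g a a' ∪ band E g b b') := by
        rintro w ⟨hw, hG⟩
        rcases band_subset_union E g a a' b b' hw with h | h
        · exact Or.inl ⟨h, hG⟩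
        · exact Or.inr h
      have h3 := (measureReal_mono (μ := P) hsub).trans (measureReal_union_le _ _)
      have h4 := measureReal_union_le (μ := P) (band E g a a') (band E g b b')
      linarith
    · have hsub : band E g a' b ∩ G ⊆ (S ∩ G) ∪ band E g q q := by
        rintro w ⟨hw, hG⟩
        rcases hqS (band_mono E g hqa hbq hw) with h | h
        · exact Or.inl ⟨h, hG⟩
        · exact Or.inr h
      have h3 := (measureReal_mono (μ := P) hsub).trans (measureReal_union_le _ _)
      rwa [measureReal_band_self P E hatom, add_zero] at h3
    · exact_mod_cast sampleCount_mono D (Set.inter_subset_inter_left _ (band_mono E g hqa hbq))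
    · exact_mod_cast sampleCount_mono D (Set.inter_subset_inter_left _ (band_mono E g haq hqb))
  have hcard : sampleCount D (band E g q q') = (umdBin J s N i).card := by
    refine sampleCount_eq_card D fun j => ?_
    simp [umdBin, band, hJ, hsdef, q, q']
  have hcardF : sampleCount D (band E g q q' ∩ F)
      = ((umdBin J s N i).filter (fun j => y j = 1)).card := by
    refine sampleCount_eq_card D fun j => ?_
    simp [umdBin, band, hJ, hsdef, q, q', hy]
  have kE := key Set.univ (by simpa using hacc a' ha' b hb) (by simpa using hacc a ha b' hb')
  have kF := key F (haccF a' ha' b hb) (haccF a ha b' hb')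
  rw [Set.inter_univ, Set.inter_univ, hcard] at kE
  rw [hcardF] at kF
  have hpN : 0 < p / N := by positivity
  have hbinge : (1 - α / 200) * (p / N) ≤ ((umdBin J s N i).card : ℝ) / n := by
    rw [le_div_iff₀ hn']
    refine le_trans ?_ (card_div_le_card_umdBin hs hJne hi)
    rw [le_div_iff₀ hN']
    refine le_trans (le_of_eq ?_) hm
    field_simp
  have hXpos : 0 < ((umdBin J s N i).card : ℝ) / n :=
    lt_of_lt_of_le (mul_pos (by linarith) hpN) hbinge
  have hval : umdValue J s y N i
      = (((umdBin J s N i).filter (fun j => y j = 1)).card : ℝ) / n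
        / (((umdBin J s N i).card : ℝ) / n) := by
    rw [umdValue, div_div_div_cancel_right₀ hn'.ne']
  have hmain := abs_sub_div_mul_le kE kF hXpos (by positivity)
    (div_le_div_of_nonneg_right (by exact_mod_cast Finset.card_filter_le _ _) hn'.le)
  rw [← hval] at hmain
  refine hmain.trans ?_
  -- the error terms are relative to the mass of the bin, which is nearly `M`
  have hρM : ρ ≤ α * M / 50 := by
    have h1 : p / N ≤ M := le_max_right _ _
    have h2 : ρ = α * (p / N) / 50 := by rw [hρ]; field_simp
    rw [h2]
    gcongr
  have hM0 : 0 < M := hpN.trans_le (le_max_right _ _)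
  have hαM : α * M ≤ M := mul_le_of_le_one_left hM0.le hα1
  have hαpN : α * (p / N) ≤ p / N := mul_le_of_le_one_left hpN.le hα1
  have hSM : 9 / 10 * M ≤ P.real S := by
    rcases max_choice (P.real (band E g a b')) (p / N) with h | h
    · -- the outer band is the larger one: compare it with the bin through the grid cells
      have hsub := (measureReal_mono (μ := P) (band_subset_union E g a q q' b')).trans
        (measureReal_union_le _ _)
      have h2 := measureReal_union_le (μ := P) (band E g a q) (band E g q' b')
      have h3 : P.real (band E g a q) ≤ ρ := (measureReal_mono (band_mono E g le_rfl hqa)).trans hρa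
      have h4 : P.real (band E g q' b') ≤ ρ :=
        (measureReal_mono (band_mono E g hbq le_rfl)).trans hρb
      have h5 := (measureReal_mono (μ := P) hqS).trans (measureReal_union_le _ _)
      rw [measureReal_band_self P E hatom, add_zero] at h5
      have h6 : M = P.real (band E g a b') := h
      linarith
    · have h6 : M = p / N := h
      have := (abs_le.1 kE).1
      rw [← h6] at hbinge hαpN
      linarith
  have h1 : α * (9 / 10 * M) ≤ α * P.real S := by gcongr
  have h0 : 0 < α * M := by positivity
  linarith

end BinValue

/-! ### From bins to level sets -/

section LevelSets

variable {Ω : Type*} [MeasurableSpace Ω]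

/-- Closeness of the conditional probability of `F` to `b` passes to finite disjoint unions. -/
theorem abs_measureReal_biUnion_sub_le {κ : Type*} (P : Measure Ω) [IsProbabilityMeasure P]
    {F : Set Ω} (hF : MeasurableSet F) (I : Finset κ) {S : κ → Set Ω}
    (hS : ∀ i ∈ I, MeasurableSet (S i)) (hd : (I : Set κ).PairwiseDisjoint S) {b c : ℝ}
    (h : ∀ i ∈ I, |P.real (S i ∩ F) - b * P.real (S i)| ≤ c * P.real (S i)) :
    |P.real ((⋃ i ∈ I, S i) ∩ F) - b * P.real (⋃ i ∈ I, S i)| ≤ c * P.real (⋃ i ∈ I, S i) := by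
  have h1 : P.real (⋃ i ∈ I, S i) = ∑ i ∈ I, P.real (S i) := measureReal_biUnion_finset hd hS
  have h2 : P.real ((⋃ i ∈ I, S i) ∩ F) = ∑ i ∈ I, P.real (S i ∩ F) := by
    rw [Set.iUnion₂_inter]
    exact measureReal_biUnion_finset
      (fun i hi j hj hij => (hd hi hj hij).mono Set.inter_subset_left Set.inter_subset_left)
      fun i hi => (hS i hi).inter hF
  rw [h1, h2, Finset.mul_sum, Finset.mul_sum, ← Finset.sum_sub_distrib]
  exact (Finset.abs_sum_le_sum_abs _ _).trans (Finset.sum_le_sum h)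

theorem measurable_umdIndex {ι : Type*} (J : Finset ι) (s : ι → ℝ) (N : ℕ) :
    Measurable (umdIndex J s N) := by
  refine Monotone.measurable fun t u htu => ?_
  exact Finset.card_le_card (Finset.monotone_filter_right _ fun _ _ h => h.trans_le htu)

theorem condProbOne_eq {𝒵 : Type*} [MeasurableSpace 𝒵] (P : Measure (𝒵 × Fin 2))
    (f : 𝒵 → unitInterval) (S : Set 𝒵) (b : unitInterval) :
    condProbOne P f S b
      = P.real (levelEvent f S b ∩ {w | w.2 = 1}) / P.real (levelEvent f S b) := by
  have hm : MeasurableSet {w : 𝒵 × Fin 2 | w.2 = 1} := measurable_snd (measurableSet_singleton 1)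
  rw [condProbOne, Measure.real, ProbabilityTheory.cond_apply' hm, ENNReal.toReal_mul,
    ENNReal.toReal_inv, div_eq_inv_mul]
  rfl

theorem condProbOne_mem_Icc {𝒵 : Type*} [MeasurableSpace 𝒵] (P : Measure (𝒵 × Fin 2))
    [IsProbabilityMeasure P] (f : 𝒵 → unitInterval) (S : Set 𝒵) (b : unitInterval) :
    condProbOne P f S b ∈ Set.Icc (0 : ℝ) 1 := by
  rw [condProbOne_eq]
  exact ⟨by positivity,
    div_le_one_of_le₀ (measureReal_mono Set.inter_subset_left) measureReal_nonneg⟩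

theorem abs_condProbOne_sub_le {𝒵 : Type*} [MeasurableSpace 𝒵] {P : Measure (𝒵 × Fin 2)}
    [IsProbabilityMeasure P] {f : 𝒵 → unitInterval} {S : Set 𝒵} {b : unitInterval} {c : ℝ}
    (h : |P.real (levelEvent f S b ∩ {w | w.2 = 1}) - b * P.real (levelEvent f S b)|
      ≤ c * P.real (levelEvent f S b)) (hpos : 0 < P (levelEvent f S b)) :
    |condProbOne P f S b - b| ≤ c := by
  have hpos' : 0 < P.real (levelEvent f S b) :=
    ENNReal.toReal_pos hpos.ne' (measure_ne_top _ _)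
  rw [condProbOne_eq, div_sub' hpos'.ne', abs_div, abs_of_pos hpos', div_le_iff₀ hpos',
    mul_comm (P.real _) (b : ℝ)]
  exact h

variable {𝒳 ℋ : Type*} [MeasurableSpace 𝒳] [MeasurableSpace ℋ] [MeasurableSingletonClass ℋ]

theorem measurableSet_slice (h : ℋ) : MeasurableSet (slice 𝒳 h) :=
  measurable_snd (measurableSet_singleton h)

/-- For `α ≥ 1` aligned calibration asks nothing. -/
theorem isAlignedCalibrated_of_one_le [LinearOrder ℋ] (P : Measure ((𝒳 × ℋ) × Fin 2))
    [IsProbabilityMeasure P] (f : 𝒳 × ℋ → unitInterval) {α : ℝ} (hα : 1 ≤ α) :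
    IsAlignedCalibrated P f α := by
  refine ⟨⟨slice 𝒳, fun h => ⟨subset_rfl, measurableSet_slice h, ?_⟩, ?_⟩,
    ∅, Set.empty_subset _, MeasurableSet.empty, ?_, ?_⟩
  · exact mul_le_of_le_one_left measureReal_nonneg (by linarith)
  · intro b' b'' h' h'' _ _ _ _
    have h1 := (condProbOne_mem_Icc P f (slice 𝒳 h') b').2
    have h2 := (condProbOne_mem_Icc P f (slice 𝒳 h'') b'').1
    linarith
  · have h1 : 0 ≤ mass P (Set.univ : Set (𝒳 × ℋ)) := measureReal_nonneg
    have h2 : mass P (∅ : Set (𝒳 × ℋ)) = 0 := by simp [mass]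
    rw [h2]
    exact mul_nonpos_of_nonpos_of_nonneg (by linarith) h1
  · intro b hb
    simp [levelEvent] at hb

variable [LinearOrder ℋ] [Fintype ℋ]

/-- If `f` is calibrated up to `α / 2` at every level on every slice, then it is `α`-aligned and
`α`-calibrated, without exceptional sets. -/
theorem isAlignedCalibrated_of_levelEvent {P : Measure ((𝒳 × ℋ) × Fin 2)} [IsProbabilityMeasure P]
    {f : 𝒳 × ℋ → unitInterval} {α : ℝ} (hα : 0 ≤ α)
    (hf : ∀ h b, MeasurableSet (levelEvent f (slice 𝒳 h) b))
    (hlev : ∀ h b, |P.real (levelEvent f (slice 𝒳 h) b ∩ {w | w.2 = 1})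
        - b * P.real (levelEvent f (slice 𝒳 h) b)| ≤ α / 2 * P.real (levelEvent f (slice 𝒳 h) b)) :
    IsAlignedCalibrated P f α := by
  refine ⟨⟨slice 𝒳, fun h => ⟨subset_rfl, measurableSet_slice h, ?_⟩, ?_⟩,
    Set.univ, subset_rfl, MeasurableSet.univ, ?_, ?_⟩
  · exact mul_le_of_le_one_left measureReal_nonneg (by linarith)
  · intro b' b'' h' h'' hb _ hpos' hpos''
    have h1 := (abs_le.1 (abs_condProbOne_sub_le (hlev h' b') hpos')).2
    have h2 := (abs_le.1 (abs_condProbOne_sub_le (hlev h'' b'') hpos'')).1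
    have h3 : (b' : ℝ) ≤ b'' := hb
    linarith
  · exact mul_le_of_le_one_left measureReal_nonneg (by linarith)
  · intro b hpos
    have hU : levelEvent f (Set.univ : Set (𝒳 × ℋ)) b
        = ⋃ h ∈ (Finset.univ : Finset ℋ), levelEvent f (slice 𝒳 h) b := by
      ext w
      simp [levelEvent, slice]
    have h1 := abs_measureReal_biUnion_sub_le P (F := {w : (𝒳 × ℋ) × Fin 2 | w.2 = 1})
      (measurable_snd (measurableSet_singleton 1)) (Finset.univ : Finset ℋ)
      (S := fun h => levelEvent f (slice 𝒳 h) b) (fun h _ => hf h b)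
      (fun h _ h' _ hne => Set.disjoint_left.2 fun w hw hw' => hne (hw.2.symm.trans hw'.2))
      (fun h _ => hlev h b)
    rw [← hU] at h1
    exact (abs_condProbOne_sub_le h1 hpos).trans (by linarith)

/-- A sample on which all bands between grid points of all slices have accurate counts yields an
aligned and calibrated confidence function. -/
theorem isAlignedCalibrated_umdConfidence {P : Measure ((𝒳 × ℋ) × Fin 2)} [IsProbabilityMeasure P]
    {fB : 𝒳 × ℋ → unitInterval} (hfB : Measurable fB)
    (hatom : ∀ u : ℝ, P ((fun w => (fB w.1 : ℝ)) ⁻¹' {u}) = 0)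
    (hpos : ∀ h : ℋ, 0 < P.real {w | w.1.2 = h}) {t : ℋ → ℝ → ℝ}
    (ht : ∀ h, IsQuantileMap P {w | w.1.2 = h} (fun w => (fB w.1 : ℝ)) (t h))
    {α : ℝ} (hα : 0 < α) (hα1 : α ≤ 1) {N n : ℕ} (hN : 0 < N) (hn : 0 < n)
    {D : Fin n → (𝒳 × ℋ) × Fin 2}
    (hacc : ∀ h, ∀ a ∈ edgeGrid (t h) (P.real {w | w.1.2 = h}) α N,
      ∀ b ∈ edgeGrid (t h) (P.real {w | w.1.2 = h}) α N,
      IsAccurate P D α (P.real {w | w.1.2 = h} / N)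
        (band {w | w.1.2 = h} (fun w => (fB w.1 : ℝ)) a b) ∧
      IsAccurate P D α (P.real {w | w.1.2 = h} / N)
        (band {w | w.1.2 = h} (fun w => (fB w.1 : ℝ)) a b ∩ {w | w.2 = 1})) :
    IsAlignedCalibrated P (umdConfidence fB N D) α := by
  classical
  set g : (𝒳 × ℋ) × Fin 2 → ℝ := fun w => (fB w.1 : ℝ) with hg
  have hgm : Measurable g := measurable_subtype_coe.comp (hfB.comp measurable_fst)
  have hE : ∀ h : ℋ, MeasurableSet {w : (𝒳 × ℋ) × Fin 2 | w.1.2 = h} := fun h =>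
    (measurable_snd.comp measurable_fst) (measurableSet_singleton h)
  have hF : MeasurableSet {w : (𝒳 × ℋ) × Fin 2 | w.2 = 1} :=
    measurable_snd (measurableSet_singleton 1)
  set J : ℋ → Finset (Fin n) := fun h => Finset.univ.filter (fun j => (D j).1.2 = h) with hJ
  set S : ℋ → ℕ → Set ((𝒳 × ℋ) × Fin 2) := fun h i =>
    {w ∈ {w | w.1.2 = h} | umdIndex (J h) (fun j => g (D j)) N (g w) = i} with hS
  have hSm : ∀ h i, MeasurableSet (S h i) := fun h i =>
    (hE h).inter (((measurable_umdIndex (J h) (fun j => g (D j)) N).comp hgm)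
      (measurableSet_singleton i))
  -- bins of equal value are merged into one level set
  have hlevel : ∀ (h : ℋ) (b : unitInterval), levelEvent (umdConfidence fB N D) (slice 𝒳 h) b
      = ⋃ i ∈ (Finset.range N).filter
          (fun i => umdValue (J h) (fun j => g (D j)) (fun j => (D j).2) N i = b), S h i := by
    intro h b
    ext w
    simp only [levelEvent, slice, Set.mem_ofPred_eq, Set.mem_iUnion, Finset.mem_filter,
      Finset.mem_range, exists_prop, hS]
    constructor
    · rintro ⟨h1, rfl⟩
      refine ⟨_, ⟨umdIndex_lt hN _, ?_⟩, rfl, rfl⟩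
      exact congrArg Subtype.val h1
    · rintro ⟨i, ⟨-, h1⟩, rfl, rfl⟩
      exact ⟨Subtype.ext h1, rfl⟩
  refine isAlignedCalibrated_of_levelEvent hα.le (fun h b => ?_) fun h b => ?_
  · rw [hlevel]
    exact Finset.measurableSet_biUnion _ fun i _ => hSm h i
  · rw [hlevel]
    refine abs_measureReal_biUnion_sub_le P hF _ (fun i _ => hSm h i)
      (fun i _ i' _ hne => Set.disjoint_left.2 fun w hw hw' => hne (hw.2.symm.trans hw'.2)) ?_
    intro i hi
    rw [Finset.mem_filter, Finset.mem_range] at hi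
    rw [← hi.2]
    exact abs_measureReal_sub_umdValue_mul_le (ht h) (hE h) hgm (fun w => (fB w.1).2) hatom
      (hpos h) hα hα1 hN hn (fun j => by simp [hJ]) (fun j => Iff.rfl)
      (fun a ha b hb => (hacc h a ha b hb).1) (fun a ha b hb => (hacc h a ha b hb).2) hi.1

end LevelSets

/-! ### The union bound -/

section UnionBound

variable {Ω : Type*} [MeasurableSpace Ω]

theorem measureReal_not_isAccurate_le (P : Measure Ω) [IsProbabilityMeasure P] {A : Set Ω}
    (hA : MeasurableSet A) {α q : ℝ} (hα : 0 ≤ α) (hα1 : α ≤ 1) (hq : 0 < q) (n : ℕ) :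
    (Measure.pi fun _ : Fin n => P).real {D | ¬ IsAccurate P D α q A}
      ≤ 2 * Real.exp (-(n * α ^ 2 * q / 160000)) := by
  set v := max (P.real A) q with hv
  have hv0 : 0 < v := hq.trans_le (le_max_right _ _)
  have h1 := sampleCount_deviation P hA (le_max_left (P.real A) q) hv0
    (ε := α / 200 * v) (by positivity) (mul_le_of_le_one_left hv0.le (by linarith)) n
  simp only [IsAccurate, not_le]
  refine h1.trans ?_
  have h2 : n * (α / 200 * v) ^ 2 / (4 * v) = n * α ^ 2 * v / 160000 := by
    field_simp
    ring
  rw [← hv, h2]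
  have h3 : q ≤ v := le_max_right _ _
  gcongr

/-- Only the slices, the number of bins and the confidence enter the number of events, so its
logarithm is absorbed by `log u`, `u = H / (λ ξ)`. The constant is `5760000 = 18 * 320000`: the
exponent is at least `18 log u`, since `γ / N ≥ γ λ / 2`, while the number of events is at most a
constant below `u ^ 12` times `u ^ 5`; what remains is `u⁻¹ ≤ ξ`. -/
theorem union_bound_le {H lam ξ α γ n : ℝ} {N : ℕ} (hH : 1 ≤ H) (hlam : 0 < lam) (hlam1 : lam ≤ 1)
    (hHlam : 2 * lam ≤ H) (hξ : 0 < ξ) (hξ1 : ξ < 1) (hα : 0 < α) (hγ : 0 < γ) (hN : 0 < N)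
    (hNlam : (N : ℝ) ≤ 2 / lam)
    (hn : 5760000 * (H / (α ^ 2 * lam * γ)) * Real.log (H / (lam * ξ)) ≤ n) :
    H * (((N + 1) * (2 * N + 1)) * ((N + 1) * (2 * N + 1))
      * (4 * Real.exp (-(n * α ^ 2 * (γ / N) / 160000)))) ≤ ξ := by
  set u := H / (lam * ξ) with hu
  have hN1 : (1 : ℝ) ≤ N := by exact_mod_cast hN
  have hu2 : 2 ≤ u := by
    rw [hu, le_div_iff₀ (by positivity)]
    nlinarith
  have hu0 : 0 < u := by linarith
  have hlog : 0 < Real.log u := Real.log_pos (by linarith)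
  have hHu : H ≤ u := by
    rw [hu, le_div_iff₀ (by positivity)]
    exact mul_le_of_le_one_right (by linarith) (mul_le_one₀ hlam1 hξ.le hξ1.le)
  have hlu : 1 / lam ≤ u := by
    rw [hu, div_le_div_iff₀ hlam (by positivity)]
    nlinarith
  have hξu : u⁻¹ ≤ ξ := by
    rw [hu, inv_div, div_le_iff₀ (by linarith)]
    nlinarith
  have hexp : 18 * Real.log u ≤ n * α ^ 2 * (γ / N) / 160000 := by
    have h1 : γ * lam / 2 ≤ γ / N := by
      rw [le_div_iff₀ (by linarith)]
      have := mul_le_mul_of_nonneg_left hNlam (show 0 ≤ γ * lam / 2 by positivity)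
      calc _ ≤ _ := this
        _ = γ := by field_simp
    have h2 : 5760000 * H * Real.log u ≤ n * (α ^ 2 * lam * γ) := by
      have := mul_le_mul_of_nonneg_right hn (show 0 ≤ α ^ 2 * lam * γ by positivity)
      refine le_trans (le_of_eq ?_) this
      field_simp
    have hn0 : 0 ≤ n := le_trans (by positivity) hn
    have h3 : n * α ^ 2 * (γ * lam / 2) ≤ n * α ^ 2 * (γ / N) := by gcongr
    have h4 : Real.log u ≤ H * Real.log u := le_mul_of_one_le_left hlog.le hH
    linarith
  have hE : Real.exp (-(n * α ^ 2 * (γ / N) / 160000)) ≤ (u ^ 18)⁻¹ := by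
    rw [← Real.exp_log (pow_pos hu0 18), ← Real.exp_neg, Real.log_pow]
    apply Real.exp_le_exp.2
    push_cast
    linarith
  have hG : ((N : ℝ) + 1) * (2 * N + 1) ≤ 24 * u ^ 2 := by
    have h1 : (N : ℝ) ≤ 2 * u := by
      refine hNlam.trans ?_
      rw [div_eq_mul_one_div]
      linarith
    have h2 : ((N : ℝ) + 1) * (2 * N + 1) ≤ (2 * N) * (3 * N) := by gcongr <;> linarith
    have h3 : (2 * (N : ℝ)) * (3 * N) ≤ (2 * (2 * u)) * (3 * (2 * u)) := by gcongr
    linarith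
  have h12 : (2304 : ℝ) ≤ u ^ 12 :=
    le_trans (by norm_num) (pow_le_pow_left₀ (by norm_num) hu2 12)
  calc H * (((N + 1) * (2 * N + 1)) * ((N + 1) * (2 * N + 1))
        * (4 * Real.exp (-(n * α ^ 2 * (γ / N) / 160000))))
      ≤ u * ((24 * u ^ 2) * (24 * u ^ 2) * (4 * (u ^ 18)⁻¹)) := by gcongr
    _ = 2304 * (u ^ 13)⁻¹ := by field_simp; norm_num
    _ ≤ u ^ 12 * (u ^ 13)⁻¹ := by gcongr
    _ = u⁻¹ := by field_simp
    _ ≤ ξ := hξu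

end UnionBound

theorem DecisionModel.isProbabilityMeasure_law {𝒟 𝒬 𝒱 𝒳 ℋ : Type*} [MeasurableSpace 𝒟]
    [MeasurableSpace 𝒬] [MeasurableSpace 𝒱] [MeasurableSpace 𝒳] [MeasurableSpace ℋ]
    (M : DecisionModel 𝒟 𝒬 𝒱 𝒳 ℋ) : IsProbabilityMeasure M.law := by
  have := M.isProbD
  have := M.isProbQ
  have hX := M.measurable_fX
  have hV := M.measurable_fV
  have hY := M.measurable_fY
  have hH := M.measurable_fH
  refine Measure.isProbabilityMeasure_map (Measurable.aemeasurable ?_)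
  fun_prop

/-- The main estimate, for an arbitrary law `P` of `(Z, Y)`: the structure of the decision model is
irrelevant. -/
theorem measure_not_isAlignedCalibrated_le {𝒳 ℋ : Type*} [MeasurableSpace 𝒳] [MeasurableSpace ℋ]
    [MeasurableSingletonClass ℋ] [LinearOrder ℋ] [Fintype ℋ]
    (P : Measure ((𝒳 × ℋ) × Fin 2)) [IsProbabilityMeasure P]
    {fB : 𝒳 × ℋ → unitInterval} (hfB : Measurable fB)
    (hatom : ∀ t : unitInterval, P {w | fB w.1 = t} = 0)
    {α lam γ ξ : ℝ} (hα : 0 < α) (hlam : 0 < lam) (hlam1 : lam ≤ 1)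
    (hHlam : 2 * lam ≤ (Fintype.card ℋ : ℝ)) (hγ : 0 < γ) (hξ : 0 < ξ) (hξ1 : ξ < 1)
    (hmass : ∀ h : ℋ, γ ≤ mass P (slice 𝒳 h)) (n : ℕ)
    (hn : 5760000 * ((Fintype.card ℋ : ℝ) / (α ^ 2 * lam * γ))
      * Real.log ((Fintype.card ℋ : ℝ) / (lam * ξ)) ≤ (n : ℝ)) :
    (Measure.pi (fun _ : Fin n => P))
      {D | ¬ IsAlignedCalibrated P (umdConfidence fB ⌈1 / lam⌉₊ D) α} ≤ ENNReal.ofReal ξ := by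
  rcases le_or_gt 1 α with hα1 | hα1
  · simp [isAlignedCalibrated_of_one_le P _ hα1]
  set N := ⌈1 / lam⌉₊ with hNdef
  have hN : 0 < N := Nat.ceil_pos.2 (by positivity)
  have hN' : (0 : ℝ) < N := by exact_mod_cast hN
  have hNlam : (N : ℝ) ≤ 2 / lam := by
    have h1 := (Nat.ceil_lt_add_one (show 0 ≤ 1 / lam by positivity)).le
    have h2 : 1 ≤ 1 / lam := (one_le_div hlam).2 hlam1
    have h3 : 2 / lam = 1 / lam + 1 / lam := by ring
    rw [← hNdef] at h1
    linarith
  have hH : (1 : ℝ) ≤ Fintype.card ℋ := by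
    have : (0 : ℝ) < Fintype.card ℋ := by linarith
    exact_mod_cast this
  have hn0 : 0 < n := by
    have hu : 1 < (Fintype.card ℋ : ℝ) / (lam * ξ) := by
      rw [lt_div_iff₀ (by positivity)]
      nlinarith
    have h1 := Real.log_pos hu
    have h2 : (0 : ℝ) < n := lt_of_lt_of_le (by positivity) hn
    exact_mod_cast h2
  set g : (𝒳 × ℋ) × Fin 2 → ℝ := fun w => (fB w.1 : ℝ) with hg
  have hgm : Measurable g := measurable_subtype_coe.comp (hfB.comp measurable_fst)
  have hatom' : ∀ u : ℝ, P (g ⁻¹' {u}) = 0 := by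
    intro u
    by_cases hu : u ∈ unitInterval
    · refine measure_mono_null (fun w hw => ?_) (hatom ⟨u, hu⟩)
      exact Subtype.ext hw
    · have : g ⁻¹' {u} = ∅ := by
        ext w
        simp only [Set.mem_preimage, Set.mem_singleton_iff, Set.mem_empty_iff_false, iff_false]
        rintro rfl
        exact hu (fB w.1).2
      simp [this]
  set E : ℋ → Set ((𝒳 × ℋ) × Fin 2) := fun h => {w | w.1.2 = h} with hEdef
  have hE : ∀ h, MeasurableSet (E h) := fun h =>
    (measurable_snd.comp measurable_fst) (measurableSet_singleton h)
  have hF : MeasurableSet {w : (𝒳 × ℋ) × Fin 2 | w.2 = 1} :=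
    measurable_snd (measurableSet_singleton 1)
  have hpγ : ∀ h, γ ≤ P.real (E h) := hmass
  have hp : ∀ h, 0 < P.real (E h) := fun h => hγ.trans_le (hpγ h)
  choose t ht using fun h => exists_isQuantileMap P hgm (fun w => (fB w.1).2) hatom'
  set G : ℋ → Finset ℝ := fun h => edgeGrid (t h) (P.real (E h)) α N with hG
  set bad : ℋ → ℝ × ℝ → Set (Fin n → (𝒳 × ℋ) × Fin 2) := fun h x =>
    {D | ¬ IsAccurate P D α (P.real (E h) / N) (band (E h) g x.1 x.2)} ∪
    {D | ¬ IsAccurate P D α (P.real (E h) / N) (band (E h) g x.1 x.2 ∩ {w | w.2 = 1})} with hbad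
  have hsub : {D : Fin n → (𝒳 × ℋ) × Fin 2 | ¬ IsAlignedCalibrated P (umdConfidence fB N D) α}
      ⊆ ⋃ h ∈ (Finset.univ : Finset ℋ), ⋃ x ∈ G h ×ˢ G h, bad h x := by
    intro D hD
    by_contra hcon
    refine hD (isAlignedCalibrated_umdConfidence hfB hatom' hp ht hα hα1.le hN hn0 ?_)
    intro h a ha b hb
    simp only [Set.mem_iUnion, not_exists] at hcon
    have h1 := hcon h (Finset.mem_univ h) (a, b) (Finset.mem_product.2 ⟨ha, hb⟩)
    simp only [hbad, Set.mem_union, Set.mem_ofPred_eq, not_or, not_not] at h1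
    exact h1
  have hbadle : ∀ h x, (Measure.pi fun _ : Fin n => P).real (bad h x)
      ≤ 4 * Real.exp (-(n * α ^ 2 * (γ / N) / 160000)) := by
    intro h x
    have hq : 0 < P.real (E h) / N := div_pos (hp h) hN'
    have hB := measurableSet_band (hE h) hgm x.1 x.2
    have h1 := measureReal_not_isAccurate_le P hB hα.le hα1.le hq n
    have h2 := measureReal_not_isAccurate_le P (hB.inter hF) hα.le hα1.le hq n
    have h3 : Real.exp (-(n * α ^ 2 * (P.real (E h) / N) / 160000))
        ≤ Real.exp (-(n * α ^ 2 * (γ / N) / 160000)) := by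
      have := hpγ h
      gcongr
    have h4 := measureReal_union_le (μ := Measure.pi fun _ : Fin n => P)
      {D | ¬ IsAccurate P D α (P.real (E h) / N) (band (E h) g x.1 x.2)}
      {D | ¬ IsAccurate P D α (P.real (E h) / N) (band (E h) g x.1 x.2 ∩ {w | w.2 = 1})}
    exact h4.trans (by linarith)
  have hcard : ∀ h, ((G h ×ˢ G h).card : ℝ)
      ≤ (((N : ℝ) + 1) * (2 * N + 1)) * ((N + 1) * (2 * N + 1)) := by
    intro h
    rw [Finset.card_product]
    have := card_edgeGrid_le (t h) (P.real (E h)) α N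
    exact_mod_cast Nat.mul_le_mul this this
  have htotal : (Measure.pi fun _ : Fin n => P).real
      (⋃ h ∈ (Finset.univ : Finset ℋ), ⋃ x ∈ G h ×ˢ G h, bad h x) ≤ ξ := by
    refine le_trans ?_ (union_bound_le hH hlam hlam1 hHlam hξ hξ1 hα hγ hN hNlam hn)
    refine (measureReal_biUnion_finset_le _ _).trans ?_
    rw [← nsmul_eq_mul, ← Finset.card_univ]
    refine Finset.sum_le_card_nsmul _ _ _ fun h _ => ?_
    refine (measureReal_biUnion_finset_le _ _).trans ?_
    refine (Finset.sum_le_card_nsmul _ _ _ fun x _ => hbadle h x).trans ?_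
    rw [nsmul_eq_mul]
    exact mul_le_mul_of_nonneg_right (hcard h) (by positivity)
  refine (measure_mono hsub).trans ?_
  rw [← ofReal_measureReal (measure_ne_top _ _)]
  exact ENNReal.ofReal_le_ofReal htotal

end HumanAligned

/-- There is a universal constant `C` such that, if the number `n` of i.i.d. calibration samples is
at least `C * |ℋ| / (α² λ γ) * log (|ℋ| / (λ ξ))`, then the event that the function returned by the
`|ℋ|` instances of uniform-mass binning with `⌈1 / λ⌉` bins fails to satisfy `α`-aligned calibration
has (outer) probability at most `ξ`. -/
theorem theorem4 :
    ∃ C : ℝ, 0 < C ∧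
      ∀ (𝒟 𝒬 𝒱 𝒳 ℋ : Type*) [MeasurableSpace 𝒟] [MeasurableSpace 𝒬] [MeasurableSpace 𝒱]
        [MeasurableSpace 𝒳] [MeasurableSpace ℋ] [MeasurableSingletonClass ℋ]
        [LinearOrder ℋ] [Fintype ℋ]
        (M : HumanAligned.DecisionModel 𝒟 𝒬 𝒱 𝒳 ℋ)
        (fB : 𝒳 × ℋ → unitInterval) (_ : Measurable fB)
        (_ : ∀ t : unitInterval, M.law {w | fB w.1 = t} = 0)
        (α lam γ ξ : ℝ) (_ : 0 < α) (_ : 0 < lam) (_ : lam ≤ 1)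
        (_ : 2 * lam ≤ (Fintype.card ℋ : ℝ)) (_ : 0 < γ) (_ : 0 < ξ) (_ : ξ < 1)
        (_ : ∀ h : ℋ, γ ≤ HumanAligned.mass M.law (HumanAligned.slice 𝒳 h))
        (n : ℕ)
        (_ : C * ((Fintype.card ℋ : ℝ) / (α ^ 2 * lam * γ))
              * Real.log ((Fintype.card ℋ : ℝ) / (lam * ξ)) ≤ (n : ℝ)),
        (Measure.pi (fun _ : Fin n => M.law))
          {D | ¬ HumanAligned.IsAlignedCalibrated M.law
                (HumanAligned.umdConfidence fB ⌈1 / lam⌉₊ D) α} ≤ ENNReal.ofReal ξ := by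
  refine ⟨5760000, by norm_num, ?_⟩
  intro 𝒟 𝒬 𝒱 𝒳 ℋ _ _ _ _ _ _ _ _ M fB hfB hatom α lam γ ξ hα hlam hlam1 hHlam hγ hξ hξ1 hmass
    n hn
  have := M.isProbabilityMeasure_law
  exact HumanAligned.measure_not_isAlignedCalibrated_le M.law hfB hatom hα hlam hlam1 hHlam hγ hξ hξ1
    hmass n hn
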